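/- Let $\sigma\in\{+1,-1\}$, $\mu\in\mathbb R$ with $|\mu|\neq 4$, and $\delta_d\in\mathbb R\setminus\{0\}$. On $\ell^2(\mathbb Z^2)\otimes\mathbb C^2$ let $S_1,S_2$ be the shifts by the two unit vectors, $X_1,X_2$ the two components of the position operator, and let $H^\sigma_\mu$ be the clean $d\pm\imath d$-wave Class C Hamiltonian $$ H^{\sigma}_\mu=\begin{pmatrix} A & B_\sigma\\ B_\sigma^* & -A\end{pmatrix},\qquad A=\tfrac12\,(S_1+S_1^*+S_2+S_2^*-\mu),\qquad B_\sigma=\tfrac{\delta_d}{2}\,(S_1+S_1^*-S_2-S_2^*)+\sigma\,\tfrac{\imath\,\delta_d}{4}\,(S_1-S_1^*)(S_2-S_2^*), $$ whose Fourier transform is $$ H^\sigma_\mu(k)=\begin{pmatrix} p_3(k) & p_1(k)-\sigma\imath\, p_2(k)\\ p_1(k)+\sigma\imath\, p_2(k) & -p_3(k)\end{pmatrix}, $$ $$ p_1(k)=\delta_d(\cos k_1-\cos k_2),\quad p_2(k)=\delta_d\sin k_1\sin k_2,\quad p_3(k)=\cos k_1+\cos k_2-\tfrac{\mu}{2}.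 $$ Then $H^\sigma_\mu$ is self-adjoint and $0$ is not in its spectrum. Let $P=\chi(H^\sigma_\mu\le 0)$ be the Fermi projection. Its Chern number $$ \mathrm{Ch}(P)=2\pi\imath\;\mathrm{Tr}\,\langle 0|\,P\,[[X_2,P],[X_1,P]]\,|0\rangle $$ is well defined (the commutators $[X_j,P]$ extend to bounded operators), and the following hold. 1. If $|\mu|<4$, then $\mathrm{Ch}(P)=-2\sigma$; that is, $\mathrm{Ch}(P)=\mp2$ for $H^{\pm}_\mu$. 2. If $|\mu|>4$, then $\mathrm{Ch}(P)=0$, and the lower Bloch bundle, with fibre $\ker\big(H^\sigma_\mu(k)-E_-(k)\big)$ over $k\in\mathbb R^2/(2\pi\mathbb Z)^2$, where $E_-(k)=-\big(p_1(k)^2+p_2(k)^2+p_3(k)^2\big)^{1/2}$, has a smooth global section of unit vectors (which spans every fibre, so that the bundle is trivial). -/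

import Mathlib

open scoped ENNReal ContDiff

noncomputable section

namespace BdG

/-- The sites of the square lattice `ℤ²`; the two coordinates are `x 0` and `x 1`. -/
abbrev Site : Type := Fin 2 → ℤ

/-- The fibre `ℂ²` with its Euclidean norm. -/
abbrev Spinor : Type := EuclideanSpace ℂ (Fin 2)

/-- The Hilbert space `ℓ²(ℤ²) ⊗ ℂ²`, as the square-summable maps `ℤ² → ℂ²`. -/
abbrev Hilb : Type := lp (fun _ : Site => Spinor) 2

/-- The state localized at the site `x` with internal state `a`. -/
def siteState (x : Site) (a : Fin 2) : Hilb :=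
  lp.single 2 x (EuclideanSpace.single a (1 : ℂ))

/-! ### Operators on `ℓ²(ℤ²) ⊗ ℂ²` -/

/-- Translation by `v`, `(T_v ψ)(x) = ψ (x - v)`, so that `T_v` maps the state at `x` to the state
at `x + v`. -/
def translation (v : Site) : Hilb →L[ℂ] Hilb :=
  LinearMap.mkContinuous
    { toFun := fun ψ => ⟨fun x => ψ (x - v), by
        have h := (lp.memℓp ψ).summable (by norm_num)
        exact memℓp_gen ((Equiv.subRight v).summable_iff.mpr h)⟩
      map_add' := fun _ _ => rfl
      map_smul' := fun _ _ => rfl }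
    1
    (fun ψ => by
      have h2 : (0 : ℝ) < (2 : ℝ≥0∞).toReal := by norm_num
      rw [one_mul, lp.norm_eq_tsum_rpow h2, lp.norm_eq_tsum_rpow h2]
      exact le_of_eq (congrArg (fun t : ℝ => t ^ (1 / (2 : ℝ≥0∞).toReal))
        ((Equiv.subRight v).tsum_eq (fun x => ‖ψ x‖ ^ (2 : ℝ≥0∞).toReal))))

@[simp] lemma translation_apply (v : Site) (ψ : Hilb) (x : Site) :
    translation v ψ x = ψ (x - v) := rfl

/-- The shift operators `S₁ = shift 0` and `S₂ = shift 1`. -/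
def shift (j : Fin 2) : Hilb →L[ℂ] Hilb := translation (Pi.single j 1)

/-- The operator `1 ⊗ M` acting by the matrix `M` on the fibre over every site. -/
def fibreOp (M : Matrix (Fin 2) (Fin 2) ℂ) : Hilb →L[ℂ] Hilb :=
  lp.mapCLM 2 (fun _ : Site => Matrix.toEuclideanCLM (n := Fin 2) (𝕜 := ℂ) M)
    (norm_nonneg _) (fun _ => le_rfl)

@[simp] lemma fibreOp_apply (M : Matrix (Fin 2) (Fin 2) ℂ) (ψ : Hilb) (x : Site) :
    fibreOp M ψ x = Matrix.toEuclideanCLM (n := Fin 2) (𝕜 := ℂ) M (ψ x) := rfl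

lemma star_translation (v : Site) : star (translation v) = translation (-v) := by
  rw [ContinuousLinearMap.star_eq_adjoint]
  symm
  rw [ContinuousLinearMap.eq_adjoint_iff]
  intro φ ψ
  rw [lp.inner_eq_tsum, lp.inner_eq_tsum, ← (Equiv.subRight v).tsum_eq]
  simp

/-- The clean `d ± i d` Hamiltonian `H^σ_μ`, `σ = ±1`, in position space. The three terms are the
Pauli matrices `σ₃`, `σ₁`, `σ₂` multiplied by
`½ (S₁ + S₁* + S₂ + S₂* - μ)`, `(δ/2) (S₁ + S₁* - S₂ - S₂*)` and
`- σ (δ/4) (S₁ - S₁*) (S₂ - S₂*)`. -/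
def hamiltonian (σ μ δ : ℝ) : Hilb →L[ℂ] Hilb :=
  (1 / 2 : ℂ) • (fibreOp !![1, 0; 0, -1] *
      (shift 0 + star (shift 0) + shift 1 + star (shift 1) - (μ : ℂ) • 1))
  + (δ / 2 : ℂ) • (fibreOp !![0, 1; 1, 0] *
      (shift 0 + star (shift 0) - shift 1 - star (shift 1)))
  - (σ * (δ / 4) : ℂ) • (fibreOp !![0, -Complex.I; Complex.I, 0] *
      ((shift 0 - star (shift 0)) * (shift 1 - star (shift 1))))

/-- The Fermi projection `χ(H ≤ 0)`, by functional calculus. (For self-adjoint `H` with `0` outside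
the spectrum, the indicator function is continuous on the spectrum.) -/
def fermiProjection {E : Type*} [NormedAddCommGroup E] [InnerProductSpace ℂ E] [CompleteSpace E]
    (H : E →L[ℂ] E) : E →L[ℂ] E :=
  cfc (Set.indicator (Set.Iic (0 : ℝ)) (fun _ => (1 : ℝ))) H

/-! ### The Chern number of a projection on `ℓ²(ℤ²) ⊗ ℂ²` -/

/-- The `j`-th component of the position operator, `(X_j ψ)(x) = x_j ψ(x)`, with its maximal
domain. -/
def position (j : Fin 2) : Hilb →ₗ.[ℂ] Hilb where
  domain :=
    { carrier := {ψ | Memℓp (fun x : Site => (x j : ℂ) • ψ x) 2}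
      add_mem' := fun {φ ψ} hφ hψ => by
        have h := Memℓp.add hφ hψ
        have e : (fun x : Site => (x j : ℂ) • (φ + ψ : Hilb) x) =
            (fun x : Site => (x j : ℂ) • φ x) + (fun x : Site => (x j : ℂ) • ψ x) := by
          funext x
          simp [smul_add]
        simpa only [Set.mem_ofPred_eq, e] using h
      zero_mem' := by
        have e : (fun x : Site => (x j : ℂ) • (0 : Hilb) x) = fun _ => 0 := by
          funext x
          simp
        simpa only [Set.mem_ofPred_eq, e] using (zero_mem_ℓp' : Memℓp (fun _ : Site => (0 : Spinor)) 2)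
      smul_mem' := fun c ψ hψ => by
        have h := Memℓp.const_smul hψ c
        have e : (fun x : Site => (x j : ℂ) • (c • ψ : Hilb) x) =
            c • (fun x : Site => (x j : ℂ) • ψ x) := by
          funext x
          simp [smul_comm c]
        simpa only [Set.mem_ofPred_eq, e] using h }
  toFun :=
    { toFun := fun ψ => ⟨fun x => (x j : ℂ) • (ψ : Hilb) x, ψ.2⟩
      map_add' := fun _ _ => Subtype.ext (funext fun _ => smul_add _ _ _)
      map_smul' := fun c ψ => Subtype.ext (funext fun x =>
        smul_comm (x j : ℂ) c ((ψ : Hilb) x)) }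

/-- The commutator `[X_j, P] = X_j P - P X_j` is defined on the domain of `X_j` and is there given by
the bounded operator `D`. -/
def IsPositionCommutator (j : Fin 2) (P D : Hilb →L[ℂ] Hilb) : Prop :=
  ∀ ψ : (position j).domain, ∃ h : P ψ ∈ (position j).domain,
    position j ⟨P ψ, h⟩ - P (position j ψ) = D ψ

/-- The bounded operator that represents `[X_j, P]` is unique. -/
lemma IsPositionCommutator.unique {j : Fin 2} {P D D' : Hilb →L[ℂ] Hilb}
    (h : IsPositionCommutator j P D) (h' : IsPositionCommutator j P D') : D = D' := by
  refine lp.ext_continuousLinearMap (by norm_num) (fun x => ?_)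
  ext1 v
  have hmem : (lp.single 2 x v : Hilb) ∈ (position j).domain := by
    have e : (fun y : Site => (y j : ℂ) • (lp.single 2 x v : Hilb) y) =
        ((lp.single 2 x ((x j : ℂ) • v) : Hilb) : Site → Spinor) := by
      funext y
      by_cases hy : y = x
      · subst hy; simp
      · rw [lp.single_apply_ne _ _ _ hy, lp.single_apply_ne _ _ _ hy, smul_zero]
    have h2 := lp.memℓp (lp.single 2 x ((x j : ℂ) • v) : Hilb)
    rw [← e] at h2
    exact h2
  obtain ⟨_, h1⟩ := h ⟨_, hmem⟩
  obtain ⟨_, h2⟩ := h' ⟨_, hmem⟩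
  exact h1.symm.trans h2

/-- The partial trace `Tr ⟨0| A |0⟩` over the fibre at the origin. -/
def originTrace (A : Hilb →L[ℂ] Hilb) : ℂ :=
  ∑ a : Fin 2, inner ℂ (siteState 0 a) (A (siteState 0 a))

/-- The Chern number of `P`, `2 π i Tr ⟨0| P [[X₂, P], [X₁, P]] |0⟩`, is defined and equal to `c`.
(The disorder average is absent because `P` is a single operator. Boundedness of the two
commutators implies the condition `∑_j Tr ⟨0| |[X_j, P]|² |0⟩ < ∞`.) -/
def HasChernNumber (P : Hilb →L[ℂ] Hilb) (c : ℂ) : Prop :=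
  ∃ D₁ D₂ : Hilb →L[ℂ] Hilb, IsPositionCommutator 0 P D₁ ∧ IsPositionCommutator 1 P D₂ ∧
    2 * Real.pi * Complex.I * originTrace (P * (D₂ * D₁ - D₁ * D₂)) = c

lemma HasChernNumber.unique {P : Hilb →L[ℂ] Hilb} {c c' : ℂ}
    (h : HasChernNumber P c) (h' : HasChernNumber P c') : c = c' := by
  obtain ⟨D₁, D₂, h1, h2, rfl⟩ := h
  obtain ⟨D₁', D₂', h1', h2', rfl⟩ := h'
  rw [h1.unique h1', h2.unique h2']

/-! ### Bloch theory -/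

/-- The coefficient of the Pauli matrix `σ₁` in the Bloch Hamiltonian. -/
def p₁ (δ : ℝ) (k : Fin 2 → ℝ) : ℝ := δ * (Real.cos (k 0) - Real.cos (k 1))

/-- The coefficient of `σ₂` (up to the sign `σ`). -/
def p₂ (δ : ℝ) (k : Fin 2 → ℝ) : ℝ := δ * (Real.sin (k 0) * Real.sin (k 1))

/-- The coefficient of `σ₃`. -/
def p₃ (μ : ℝ) (k : Fin 2 → ℝ) : ℝ := Real.cos (k 0) + Real.cos (k 1) - μ / 2

/-- The Fourier transform `H^σ_μ(k)` of the Hamiltonian. -/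
def blochHamiltonian (σ μ δ : ℝ) (k : Fin 2 → ℝ) : Matrix (Fin 2) (Fin 2) ℂ :=
  !![(p₃ μ k : ℂ), p₁ δ k - σ * Complex.I * p₂ δ k;
     p₁ δ k + σ * Complex.I * p₂ δ k, -(p₃ μ k : ℂ)]

/-- The Fourier transform `ψ̂(k) = ∑_x e^{- i k·x} ψ(x)` of a summable `ψ`. -/
def fourier (ψ : Site → Spinor) (k : Fin 2 → ℝ) : Spinor :=
  ∑' x : Site, Complex.exp (-Complex.I * (k 0 * x 0 + k 1 * x 1)) • ψ x

lemma fourier_translation (ψ : Site → Spinor) (v : Site) (k : Fin 2 → ℝ) :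
    fourier (fun x => ψ (x - v)) k =
      Complex.exp (-Complex.I * (k 0 * v 0 + k 1 * v 1)) • fourier ψ k := by
  unfold fourier
  rw [← (Equiv.addRight v).tsum_eq, ← tsum_const_smul'']
  refine tsum_congr fun x => ?_
  rw [smul_smul, ← Complex.exp_add]
  simp only [Equiv.coe_addRight, add_sub_cancel_right, Pi.add_apply, Int.cast_add]
  ring_nf

lemma summable_phase {ψ : Site → Spinor} (h : Summable fun x => ‖ψ x‖) (k : Fin 2 → ℝ) :
    Summable fun x : Site => Complex.exp (-Complex.I * (k 0 * x 0 + k 1 * x 1)) • ψ x := by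
  refine Summable.of_norm (h.congr fun x => ?_)
  have e : -Complex.I * ((k 0 : ℂ) * x 0 + k 1 * x 1)
      = ((-(k 0 * x 0 + k 1 * x 1) : ℝ) : ℂ) * Complex.I := by
    push_cast; ring
  rw [norm_smul, e, Complex.norm_exp_ofReal_mul_I, one_mul]

lemma blochHamiltonian_eq (σ μ δ : ℝ) (k : Fin 2 → ℝ) :
    (1 / 2 : ℂ) • (!![1, 0; 0, -1] *
      (!![Complex.exp (-Complex.I * k 0), 0; 0, Complex.exp (-Complex.I * k 0)]
        + !![Complex.exp (Complex.I * k 0), 0; 0, Complex.exp (Complex.I * k 0)]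
        + !![Complex.exp (-Complex.I * k 1), 0; 0, Complex.exp (-Complex.I * k 1)]
        + !![Complex.exp (Complex.I * k 1), 0; 0, Complex.exp (Complex.I * k 1)]
        - (μ : ℂ) • !![1, 0; 0, 1]))
    + (δ / 2 : ℂ) • (!![0, 1; 1, 0] *
      (!![Complex.exp (-Complex.I * k 0), 0; 0, Complex.exp (-Complex.I * k 0)]
        + !![Complex.exp (Complex.I * k 0), 0; 0, Complex.exp (Complex.I * k 0)]
        - !![Complex.exp (-Complex.I * k 1), 0; 0, Complex.exp (-Complex.I * k 1)]
        - !![Complex.exp (Complex.I * k 1), 0; 0, Complex.exp (Complex.I * k 1)]))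
    - (σ * (δ / 4) : ℂ) • (!![0, -Complex.I; Complex.I, 0] *
      ((!![Complex.exp (-Complex.I * k 0), 0; 0, Complex.exp (-Complex.I * k 0)]
        - !![Complex.exp (Complex.I * k 0), 0; 0, Complex.exp (Complex.I * k 0)]) *
       (!![Complex.exp (-Complex.I * k 1), 0; 0, Complex.exp (-Complex.I * k 1)]
        - !![Complex.exp (Complex.I * k 1), 0; 0, Complex.exp (Complex.I * k 1)])))
    = blochHamiltonian σ μ δ k := by
  have hc : ∀ j, ((Real.cos (k j) : ℝ) : ℂ) =
      (Complex.exp (Complex.I * k j) + Complex.exp (-Complex.I * k j)) / 2 := by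
    intro j
    rw [Complex.ofReal_cos, Complex.cos]
    ring_nf
  have hs : ∀ j, ((Real.sin (k j) : ℝ) : ℂ) =
      (Complex.exp (-Complex.I * k j) - Complex.exp (Complex.I * k j)) * Complex.I / 2 := by
    intro j
    rw [Complex.ofReal_sin, Complex.sin]
    ring_nf
  have hI : Complex.I ^ 3 = -Complex.I := Complex.I_pow_three
  simp only [blochHamiltonian, p₁, p₂, p₃, Complex.ofReal_mul, Complex.ofReal_sub,
    Complex.ofReal_add, Complex.ofReal_div, hc, hs]
  generalize Complex.exp (-Complex.I * k 0) = u, Complex.exp (Complex.I * k 0) = u',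
    Complex.exp (-Complex.I * k 1) = w, Complex.exp (Complex.I * k 1) = w'
  ext a b
  fin_cases a <;> fin_cases b <;> simp <;> ring_nf <;> simp only [hI] <;> ring

/-- The Fourier transform turns `H^σ_μ` into multiplication by `H^σ_μ(k)`. -/
lemma fourier_hamiltonian (σ μ δ : ℝ) (ψ : Hilb) (h : Summable fun x => ‖ψ x‖)
    (k : Fin 2 → ℝ) :
    fourier (fun x => hamiltonian σ μ δ ψ x) k =
      Matrix.toEuclideanCLM (n := Fin 2) (𝕜 := ℂ) (blochHamiltonian σ μ δ k)
        (fourier (fun x => ψ x) k) := by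
  let F : Matrix (Fin 2) (Fin 2) ℂ → Spinor →L[ℂ] Spinor :=
    fun M => Matrix.toEuclideanCLM (n := Fin 2) (𝕜 := ℂ) M
  let R : (Hilb →L[ℂ] Hilb) → Matrix (Fin 2) (Fin 2) ℂ → Prop := fun A M =>
    ∀ φ : Hilb, (Summable fun x => ‖φ x‖) →
      (Summable fun x => ‖A φ x‖) ∧ 
        fourier (fun x => A φ x) k = F M (fourier (fun x => φ x) k)
  have hadd : ∀ A B M N, R A M → R B N → R (A + B) (M + N) := by
    intro A B M N hA hB φ hφ
    obtain ⟨a1, a2⟩ := hA φ hφ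
    obtain ⟨b1, b2⟩ := hB φ hφ
    refine ⟨Summable.of_nonneg_of_le (fun _ => norm_nonneg _) (fun x => ?_) (a1.add b1), ?_⟩
    · simpa using norm_add_le (A φ x) (B φ x)
    · have e : F (M + N) = F M + F N := map_add _ M N
      have e' : fourier (fun x => (A + B) φ x) k =
          fourier (fun x => A φ x) k + fourier (fun x => B φ x) k :=
        (tsum_congr fun x => smul_add _ _ _).trans
          ((summable_phase a1 k).tsum_add (summable_phase b1 k))
      rw [e]
      exact e'.trans (congrArg₂ (· + ·) a2 b2)
  have hsmul : ∀ (c : ℂ) A M, R A M → R (c • A) (c • M) := by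
    intro c A M hA φ hφ
    obtain ⟨a1, a2⟩ := hA φ hφ
    refine ⟨(a1.mul_left ‖c‖).congr fun x => ?_, ?_⟩
    · exact (norm_smul c (A φ x)).symm
    · have e : F (c • M) = c • F M := map_smul _ c M
      have e' : fourier (fun x => (c • A) φ x) k = c • fourier (fun x => A φ x) k :=
        (tsum_congr fun x => smul_comm _ c (A φ x)).trans (tsum_const_smul'' c)
      rw [e]
      exact e'.trans (congrArg (c • ·) a2)
  have hsub : ∀ A B M N, R A M → R B N → R (A - B) (M - N) := by
    intro A B M N hA hB
    have := hadd _ _ _ _ hA (hsmul (-1) _ _ hB)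
    simpa [sub_eq_add_neg] using this
  have hmul : ∀ A B M N, R A M → R B N → R (A * B) (M * N) := by
    intro A B M N hA hB φ hφ
    obtain ⟨b1, b2⟩ := hB φ hφ
    obtain ⟨a1, a2⟩ := hA (B φ) b1
    refine ⟨a1, ?_⟩
    have e : F (M * N) = F M * F N := map_mul _ M N
    rw [e]
    exact a2.trans (congrArg (F M) b2)
  have htr : ∀ v, R (translation v) (Complex.exp (-Complex.I * (k 0 * v 0 + k 1 * v 1)) • 1) := by
    intro v φ hφ
    refine ⟨(Equiv.subRight v).summable_iff.mpr hφ, ?_⟩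
    simp only [F, map_smul, map_one]
    exact fourier_translation (fun x => φ x) v k
  have hfib : ∀ M, R (fibreOp M) M := by
    intro M φ hφ
    refine ⟨Summable.of_nonneg_of_le (fun _ => norm_nonneg _)
      (fun x => (F M).le_opNorm (φ x)) (hφ.mul_left ‖F M‖), ?_⟩
    unfold fourier
    rw [ContinuousLinearMap.map_tsum _ (summable_phase hφ k)]
    refine tsum_congr fun x => ?_
    rw [map_smul]
    rfl
  have hz : ∀ z : ℂ, z • (1 : Matrix (Fin 2) (Fin 2) ℂ) = !![z, 0; 0, z] := by
    intro z
    ext a b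
    fin_cases a <;> fin_cases b <;> simp
  have hone : R 1 !![1, 0; 0, 1] := by
    rw [← hz, one_smul]
    exact fun φ hφ => ⟨hφ, by simp [F]⟩
  have hS : ∀ j, R (shift j) !![Complex.exp (-Complex.I * k j), 0; 0, Complex.exp (-Complex.I * k j)] := by
    intro j
    rw [← hz]
    have := htr (Pi.single j 1)
    fin_cases j <;> simpa [shift] using this
  have hS' : ∀ j, R (star (shift j)) !![Complex.exp (Complex.I * k j), 0; 0, Complex.exp (Complex.I * k j)] := by
    intro j
    rw [← hz]
    have := htr (-Pi.single j 1)
    rw [← star_translation] at this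
    fin_cases j <;> simpa [shift] using this
  have key := hsub _ _ _ _ (hadd _ _ _ _
    (hsmul (1 / 2) _ _ (hmul _ _ _ _ (hfib !![1, 0; 0, -1])
      (hsub _ _ _ _ (hadd _ _ _ _ (hadd _ _ _ _ (hadd _ _ _ _ (hS 0) (hS' 0)) (hS 1)) (hS' 1))
        (hsmul μ _ _ hone))))
    (hsmul (δ / 2) _ _ (hmul _ _ _ _ (hfib !![0, 1; 1, 0])
      (hsub _ _ _ _ (hsub _ _ _ _ (hadd _ _ _ _ (hS 0) (hS' 0)) (hS 1)) (hS' 1)))))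
    (hsmul (σ * (δ / 4)) _ _ (hmul _ _ _ _ (hfib !![0, -Complex.I; Complex.I, 0])
      (hmul _ _ _ _ (hsub _ _ _ _ (hS 0) (hS' 0)) (hsub _ _ _ _ (hS 1) (hS' 1)))))
  refine (key ψ h).2.trans (congrArg (fun M => F M (fourier (fun x => ψ x) k)) ?_)
  exact blochHamiltonian_eq σ μ δ k

/-- The lower Bloch band `E₋(k)`. -/
def lowerBand (μ δ : ℝ) (k : Fin 2 → ℝ) : ℝ :=
  -Real.sqrt (p₁ δ k ^ 2 + p₂ δ k ^ 2 + p₃ μ k ^ 2)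

/-- The fibre over `k` of the lower Bloch bundle, the eigenspace of `H^σ_μ(k)` for `E₋(k)`. -/
def lowerBlochFibre (σ μ δ : ℝ) (k : Fin 2 → ℝ) : Submodule ℂ Spinor :=
  Module.End.eigenspace (Matrix.toEuclideanLin (blochHamiltonian σ μ δ k)) (lowerBand μ δ k : ℂ)

/-- The lower Bloch bundle over the torus `ℝ² / (2πℤ)²` has a global smooth normalized section
(which then spans every fibre, so that the bundle is a trivial line bundle). -/
def HasGlobalBlochSection (σ μ δ : ℝ) : Prop :=
  ∃ v : (Fin 2 → ℝ) → Spinor, ContDiff ℝ ∞ v ∧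
    (∀ k j, v (k + Pi.single j (2 * Real.pi)) = v k) ∧
    (∀ k, ‖v k‖ = 1) ∧
    ∀ k, Submodule.span ℂ {v k} = lowerBlochFibre σ μ δ k

end BdG

end

/-!
The Hamiltonian is translation invariant, so the Fourier transform `ℓ²(ℤ²) ≅ L²(𝕋²)` turns it into
multiplication by the matrix `p · σ` with `p = (p₁, σ p₂, p₃)`. Matrices of continuous functions on the
torus are represented by the `*`-homomorphism `symbolOp` on `ℓ²(ℤ²) ⊗ ℂ²`, so all algebraic relations
between operators can be checked on symbols. The square of `p · σ` is the scalar `E² = |p|²`, which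
is positive (`energy_pos`); hence the operator with symbol `E` is `|H|`, and the Fermi projection has
symbol `(1 - n · σ) / 2` with `n = p / E` (`fermiProjection_eq`, `spectrum_and_fermiProjection`).

The commutator with `X_j` of an operator with `C¹` symbol has as symbol `-i` times the `j`-th partial
derivative (`isPositionCommutator_symbolOp`), and the trace per site is the integral of the trace of
the symbol (`originTrace_symbolOp`). So the Chern number is `(4π)⁻¹ ∫ n · (∂₁n × ∂₂n)`
(`hasChernNumber_fermiProjection`), the degree of `n : 𝕋² → S²`.

The degree is computed from the identity `p₁² + p₂² = δ² w²` with `w = 1 - cos k₁ cos k₂`. It gives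
`n · (∂₁n × ∂₂n) = σ (sin k₁ ∂₁n₃ + sin k₂ ∂₂n₃) / w`, which for each `η = ±1` is `-σ η` times the
divergence of the field `(sin k₁, sin k₂) (1 - η n₃) / w`. The field is smooth where `n₃ ≠ -η`. The only
zeros of `w` are `(0, 0)` and `(π, π)`, and they are separated by the circles `k₁ = ±π/2`, on which
`w = 1`. Using in each of the two cylinders the sign `η` of `p₃` at its zero of `w`, Stokes' theorem
gives `Ch = σ (n₃(π, π) - n₃(0, 0))` (`integral_curvature`, `hasChernNumber_sign`). Here
`p₃ = 2 - μ/2` at `(0, 0)` and `p₃ = -2 - μ/2` at `(π, π)`: the signs differ if and only if `|μ| < 4`.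

If `|μ| > 4`, then `p₃` has a constant sign, so `n` avoids one of the poles, and projecting the
corresponding constant spin state onto the lower band gives the global section
(`hasGlobalBlochSection_of_sign`).
-/

namespace BdG

open MeasureTheory UnitAddTorus

/-! ### Multiplication operators on `L²` -/

section Multiplication

variable {X : Type*} [TopologicalSpace X] [CompactSpace X] [MeasurableSpace X] [BorelSpace X]
  (ν : Measure X) [IsFiniteMeasure ν]

/-- Multiplication by the continuous function `f` on `L²`, as a bounded operator. -/
noncomputable def multiplication (f : C(X, ℂ)) : Lp ℂ 2 ν →L[ℂ] Lp ℂ 2 ν :=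
  (ContinuousLinearMap.mul ℂ ℂ).holderL ν ∞ 2 2 (ContinuousMap.toLp ∞ ν ℂ f)

lemma multiplication_coeFn (f : C(X, ℂ)) (φ : Lp ℂ 2 ν) :
    multiplication ν f φ =ᵐ[ν] fun t => f t * φ t := by
  have h1 := (ContinuousLinearMap.mul ℂ ℂ).coeFn_holder (r := 2)
    (ContinuousMap.toLp ∞ ν ℂ f) φ
  have h2 := ContinuousMap.coeFn_toLp (p := ∞) ν (𝕜 := ℂ) f
  filter_upwards [h1, h2] with t h1 h2
  rw [← h2]
  exact h1

lemma multiplication_toLp (f g : C(X, ℂ)) :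
    multiplication ν f (ContinuousMap.toLp 2 ν ℂ g) = ContinuousMap.toLp 2 ν ℂ (f * g) := by
  ext1
  filter_upwards [multiplication_coeFn ν f (ContinuousMap.toLp 2 ν ℂ g),
    ContinuousMap.coeFn_toLp (p := 2) ν (𝕜 := ℂ) g,
    ContinuousMap.coeFn_toLp (p := 2) ν (𝕜 := ℂ) (f * g)] with t h1 h2 h3
  rw [h1, h2, h3, ContinuousMap.mul_apply]

/-- Multiplication operators form a representation of the `*`-algebra of continuous functions. -/
noncomputable def multiplicationHom : C(X, ℂ) →⋆ₐ[ℂ] (Lp ℂ 2 ν →L[ℂ] Lp ℂ 2 ν) where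
  toFun := multiplication ν
  map_one' := by
    ext1 φ; ext1
    filter_upwards [multiplication_coeFn ν 1 φ] with t h
    simp [h]
  map_mul' f g := by
    ext1 φ; ext1
    filter_upwards [multiplication_coeFn ν (f * g) φ, multiplication_coeFn ν f (multiplication ν g φ),
      multiplication_coeFn ν g φ] with t h1 h2 h3
    rw [mul_apply_eq_comp, h1, h2, h3, ContinuousMap.mul_apply, mul_assoc]
  map_zero' := by simp [multiplication]
  map_add' f g := by simp [multiplication]
  commutes' c := by
    ext1 φ; ext1
    filter_upwards [multiplication_coeFn ν (algebraMap ℂ C(X, ℂ) c) φ, Lp.coeFn_smul c φ] with t h h'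
    rw [h, Algebra.algebraMap_eq_smul_one, Algebra.algebraMap_eq_smul_one]
    simp [h']
  map_star' f := by
    rw [ContinuousLinearMap.star_eq_adjoint, ContinuousLinearMap.eq_adjoint_iff]
    intro φ χ
    rw [L2.inner_def, L2.inner_def]
    refine integral_congr_ae ?_
    filter_upwards [multiplication_coeFn ν (star f) φ, multiplication_coeFn ν f χ] with t h1 h2
    rw [h1, h2]
    simp only [RCLike.inner_apply, ContinuousMap.star_apply, map_mul, RCLike.star_def,
      RCLike.conj_conj]
    ring

lemma multiplicationHom_apply (f : C(X, ℂ)) :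
    multiplicationHom ν f = multiplication ν f := rfl

end Multiplication

/-! ### The operators with a given symbol -/

/-- The Brillouin torus, with the quasi-momentum `k = 2πt`. -/
abbrev Torus : Type := UnitAddTorus (Fin 2)

/-- The circle carries its normalized Haar measure, as it does for `mFourierBasis`. -/
noncomputable local instance : MeasureSpace UnitAddCircle := ⟨AddCircle.haarAddCircle⟩

local instance : Measure.IsAddHaarMeasure (volume : Measure UnitAddCircle) :=
  inferInstanceAs (Measure.IsAddHaarMeasure AddCircle.haarAddCircle)

local instance : IsProbabilityMeasure (volume : Measure UnitAddCircle) :=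
  inferInstanceAs (IsProbabilityMeasure AddCircle.haarAddCircle)

/-- The Hilbert space `L²` over the Brillouin torus. -/
abbrev TorusL2 : Type := Lp ℂ 2 (volume : Measure Torus)

lemma mFourierBasis_apply (x : Site) :
    (mFourierBasis (d := Fin 2)) x = ContinuousMap.toLp 2 (volume : Measure Torus) ℂ (mFourier x) := by
  rw [coe_mFourierBasis]

/-- The internal component `a` of a state, as a function on the torus. -/
noncomputable def component (a : Fin 2) : Hilb →L[ℂ] TorusL2 :=
  (mFourierBasis (d := Fin 2)).repr.symm.toContinuousLinearEquiv.toContinuousLinearMap ∘L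
    lp.mapCLM 2 (fun _ : Site => (EuclideanSpace.proj a : Spinor →L[ℂ] ℂ)) (norm_nonneg _)
      (fun _ => le_rfl)

/-- The state with internal component `a` given by a function on the torus, and the other one
zero. -/
noncomputable def inclusion (a : Fin 2) : TorusL2 →L[ℂ] Hilb :=
  lp.mapCLM 2 (fun _ : Site => ContinuousLinearMap.toSpanSingleton ℂ
      (EuclideanSpace.single a (1 : ℂ) : Spinor)) (norm_nonneg _) (fun _ => le_rfl) ∘L
    (mFourierBasis (d := Fin 2)).repr.toContinuousLinearEquiv.toContinuousLinearMap

lemma repr_component (a : Fin 2) (ψ : Hilb) (x : Site) :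
    (mFourierBasis (d := Fin 2)).repr (component a ψ) x = ψ x a := by
  simp [component]

lemma inclusion_apply (a b : Fin 2) (φ : TorusL2) (x : Site) :
    inclusion a φ x b = if b = a then (mFourierBasis (d := Fin 2)).repr φ x else 0 := by
  simp [inclusion]

lemma component_comp_inclusion (a b : Fin 2) :
    component a ∘L inclusion b = if a = b then 1 else 0 := by
  ext1 φ
  apply (mFourierBasis (d := Fin 2)).repr.injective
  ext x
  rw [ContinuousLinearMap.comp_apply, repr_component, inclusion_apply]
  split_ifs <;> simp

lemma sum_inclusion_comp_component :
    ∑ a : Fin 2, inclusion a ∘L component a = 1 := by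
  ext ψ x b
  rw [Fin.sum_univ_two]
  simp only [add_apply, ContinuousLinearMap.comp_apply, lp.coeFn_add, Pi.add_apply,
    PiLp.add_apply, inclusion_apply, repr_component]
  fin_cases b <;> simp

lemma adjoint_component (a : Fin 2) :
    ContinuousLinearMap.adjoint (component a) = inclusion a := by
  symm
  rw [ContinuousLinearMap.eq_adjoint_iff]
  intro φ ψ
  rw [← (mFourierBasis (d := Fin 2)).repr.inner_map_map, lp.inner_eq_tsum, lp.inner_eq_tsum]
  refine tsum_congr fun x => ?_
  rw [repr_component, PiLp.inner_apply, Fin.sum_univ_two, inclusion_apply, inclusion_apply]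
  fin_cases a <;> simp

lemma adjoint_inclusion (a : Fin 2) :
    ContinuousLinearMap.adjoint (inclusion a) = component a := by
  rw [← adjoint_component, ContinuousLinearMap.adjoint_adjoint]

/-- The translation-invariant operator whose symbol is the matrix-valued function `A` on the
torus. -/
noncomputable def symbolOp :
    Matrix (Fin 2) (Fin 2) C(Torus, ℂ) →⋆ₐ[ℂ] (Hilb →L[ℂ] Hilb) where
  toFun A := ∑ a, ∑ b, inclusion a ∘L multiplicationHom volume (A a b) ∘L component b
  map_one' := by
    rw [← sum_inclusion_comp_component]
    simp [Fin.sum_univ_two, Matrix.one_apply, ContinuousLinearMap.one_def]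
  map_mul' A B := by
    have h : ∀ a b c d : Fin 2, ∀ M N : TorusL2 →L[ℂ] TorusL2,
        (inclusion a ∘L M ∘L component b) * (inclusion c ∘L N ∘L component d) =
          if b = c then inclusion a ∘L (M * N) ∘L component d else 0 := by
      intro a b c d M N
      ext1 ψ
      have := DFunLike.congr_fun (component_comp_inclusion b c) (N (component d ψ))
      simp only [ContinuousLinearMap.comp_apply] at this
      simp only [mul_apply_eq_comp, ContinuousLinearMap.comp_apply, this]
      split_ifs <;> simp
    simp only [Fin.sum_univ_two, add_mul, mul_add, h, Matrix.mul_apply, map_add, map_mul]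
    simp only [ContinuousLinearMap.add_comp, ContinuousLinearMap.comp_add]
    simp
    abel
  map_zero' := by simp
  map_add' A B := by
    simp only [Matrix.add_apply, map_add, ContinuousLinearMap.add_comp,
      ContinuousLinearMap.comp_add, Finset.sum_add_distrib]
  commutes' c := by
    rw [Algebra.algebraMap_eq_smul_one, Algebra.algebraMap_eq_smul_one,
      ← sum_inclusion_comp_component]
    simp [Fin.sum_univ_two, Matrix.one_apply, ContinuousLinearMap.one_def]
  map_star' A := by
    simp only [Fin.sum_univ_two, star_add, Matrix.star_apply, map_star]
    simp only [ContinuousLinearMap.star_eq_adjoint, ContinuousLinearMap.adjoint_comp,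
      adjoint_component, adjoint_inclusion, ContinuousLinearMap.comp_assoc]
    abel

lemma symbolOp_apply (A : Matrix (Fin 2) (Fin 2) C(Torus, ℂ)) (ψ : Hilb) (x : Site) (a : Fin 2) :
    symbolOp A ψ x a = ∑ b, (mFourierBasis (d := Fin 2)).repr
      (multiplication volume (A a b) (component b ψ)) x := by
  change (∑ a, ∑ b, inclusion a ∘L multiplicationHom volume (A a b) ∘L component b) ψ x a = _
  simp only [Fin.sum_univ_two, add_apply, ContinuousLinearMap.comp_apply, lp.coeFn_add, Pi.add_apply,
    PiLp.add_apply, inclusion_apply, multiplicationHom_apply]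
  fin_cases a <;> simp

lemma star_mFourier (n : Site) : star (mFourier n : C(Torus, ℂ)) = mFourier (-n) := by
  ext t
  rw [ContinuousMap.star_apply, mFourier_neg]
  rfl

lemma mFourier_mul (m n : Site) : (mFourier m * mFourier n : C(Torus, ℂ)) = mFourier (m + n) := by
  ext t
  rw [ContinuousMap.mul_apply, mFourier_add]

lemma repr_multiplication (f : C(Torus, ℂ)) (φ : TorusL2) (x : Site) :
    (mFourierBasis (d := Fin 2)).repr (multiplication volume f φ) x =
      inner ℂ (ContinuousMap.toLp 2 (volume : Measure Torus) ℂ (star f * mFourier x)) φ := by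
  rw [HilbertBasis.repr_apply_apply, mFourierBasis_apply, ← multiplication_toLp,
    ← multiplicationHom_apply, ← multiplicationHom_apply, map_star,
    ContinuousLinearMap.star_eq_adjoint, ContinuousLinearMap.adjoint_inner_left]

/-- Since `mFourier x` is `e^{i k·x}`, the symbol of a translation by `v` is `e^{i k·v}`, which is the
complex conjugate of the factor in `fourier_translation`. -/
lemma translation_eq_symbolOp (v : Site) :
    translation v = symbolOp (Matrix.diagonal fun _ => mFourier v) := by
  ext ψ x a
  have h : (mFourierBasis (d := Fin 2)).repr (multiplication volume (mFourier v) (component a ψ)) x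
      = ψ (x - v) a := by
    rw [repr_multiplication, star_mFourier, mFourier_mul, ← mFourierBasis_apply,
      ← HilbertBasis.repr_apply_apply, repr_component, neg_add_eq_sub]
  have h0 : multiplication (volume : Measure Torus) 0 = 0 := map_zero (multiplicationHom volume)
  rw [symbolOp_apply, translation_apply, ← h, Fin.sum_univ_two]
  fin_cases a <;> simp [h0]

lemma fibreOp_eq_symbolOp (M : Matrix (Fin 2) (Fin 2) ℂ) :
    fibreOp M = symbolOp (M.map (algebraMap ℂ C(Torus, ℂ))) := by
  ext ψ x a
  have h : ∀ c b, (mFourierBasis (d := Fin 2)).repr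
      (multiplication volume (algebraMap ℂ C(Torus, ℂ) c) (component b ψ)) x = c * ψ x b := by
    intro c b
    rw [← multiplicationHom_apply, AlgHomClass.commutes, Algebra.algebraMap_eq_smul_one]
    simp [repr_component]
  rw [symbolOp_apply, fibreOp_apply]
  simp only [Matrix.map_apply, h, Matrix.ofLp_toEuclideanCLM, Matrix.mulVec, dotProduct]

/-- The integral kernel of multiplication by `f` in the Fourier basis. -/
lemma hasSum_repr_multiplication (f : C(Torus, ℂ)) (b : Fin 2) (ψ : Hilb) (x : Site) :
    HasSum (fun y => mFourierCoeff f (x - y) * ψ y b)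
      ((mFourierBasis (d := Fin 2)).repr (multiplication volume f (component b ψ)) x) := by
  rw [repr_multiplication]
  refine ((mFourierBasis (d := Fin 2)).hasSum_inner_mul_inner _ _).congr_fun fun y => ?_
  rw [← HilbertBasis.repr_apply_apply _ (component b ψ), repr_component, mFourierBasis_apply,
    ContinuousMap.inner_toLp]
  congr 1
  refine integral_congr_ae (.of_forall fun t => ?_)
  have : mFourier (-(x - y)) t = mFourier (-x) t * mFourier y t := by
    rw [← mFourier_add]; congr 2; abel
  simp only [this, mFourier_neg, smul_eq_mul, ContinuousMap.mul_apply, ContinuousMap.star_apply,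
    map_mul, RCLike.star_def, Complex.conj_conj]
  ring

lemma originTrace_symbolOp (A : Matrix (Fin 2) (Fin 2) C(Torus, ℂ)) :
    originTrace (symbolOp A) = ∫ t : Torus, A.trace t := by
  have h1 : ∀ a b, (mFourierBasis (d := Fin 2)).repr
      (multiplication volume (A a b) (component b (siteState 0 a))) 0 =
        if a = b then ∫ t, A a b t else 0 := by
    intro a b
    have h := hasSum_repr_multiplication (A a b) b (siteState 0 a) 0
    refine h.unique ?_
    have h2 : (if a = b then ∫ t, A a b t else 0) =
        mFourierCoeff (A a b) ((0 : Site) - 0) * siteState 0 a 0 b := by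
      have : siteState 0 a 0 b = if b = a then 1 else 0 := by
        simp [siteState]
      rw [this]
      by_cases hab : a = b
      · subst hab; simp [mFourierCoeff, mFourier_zero]
      · simp [hab, Ne.symm hab]
    rw [h2]
    refine hasSum_single 0 fun y hy => ?_
    rw [siteState, lp.single_apply_ne _ _ _ hy]
    simp
  have h2 : ∀ (a : Fin 2) (ψ : Hilb), inner ℂ (siteState 0 a) ψ = ψ 0 a := by
    intro a ψ
    rw [siteState, lp.inner_single_left, EuclideanSpace.inner_single_left]
    simp
  have hi : ∀ a, Integrable (fun t => A a a t) (volume : Measure Torus) := fun a =>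
    (A a a).continuous.integrable_of_hasCompactSupport
      (HasCompactSupport.of_compactSpace _)
  simp only [originTrace, h2, symbolOp_apply, h1, Fin.sum_univ_two, Matrix.trace, Matrix.diag,
    ContinuousMap.add_apply]
  rw [integral_add (hi 0) (hi 1)]
  simp

/-! ### Integration and differentiation over the torus -/

/-- The point of the torus with quasi-momentum `k`. -/
noncomputable def torusPoint (k : Fin 2 → ℝ) : Torus :=
  fun j => ((k j / (2 * Real.pi) : ℝ) : UnitAddCircle)

lemma continuous_torusPoint : Continuous torusPoint :=
  continuous_pi fun j => (AddCircle.continuous_mk' 1).comp (by fun_prop)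

lemma torusPoint_add_single (k : Fin 2 → ℝ) (j : Fin 2) :
    torusPoint (k + Pi.single j (2 * Real.pi)) = torusPoint k := by
  funext i
  simp only [torusPoint, Pi.add_apply]
  by_cases h : i = j
  · subst h
    rw [Pi.single_eq_same, add_div, div_self (by positivity), AddCircle.coe_add,
      AddCircle.coe_period, add_zero]
  · simp [h]

lemma torusPoint_update_add (k : Fin 2 → ℝ) (j : Fin 2) (s : ℝ) :
    torusPoint (Function.update k j (s + 2 * Real.pi)) = torusPoint (Function.update k j s) := by
  rw [← torusPoint_add_single (Function.update k j s) j]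
  congr 1
  funext i
  by_cases h : i = j
  · subst h; simp
  · simp [h]

lemma integral_torus_eq {F : Torus → ℂ} (hF : Continuous F) (u v : ℝ) :
    ∫ t : Torus, F t = (2 * Real.pi : ℂ)⁻¹ ^ 2 *
      ∫ a in u..u + 2 * Real.pi, ∫ b in v..v + 2 * Real.pi, F (torusPoint ![a, b]) := by
  have hpi : (2 * Real.pi) ≠ 0 := by positivity
  let G : ℝ × ℝ → ℂ := fun p => F ![(p.1 : UnitAddCircle), (p.2 : UnitAddCircle)]
  have hG : Continuous G := hF.comp <| continuous_pi fun j => by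
    fin_cases j
    · exact (AddCircle.continuous_mk' 1).comp continuous_fst
    · exact (AddCircle.continuous_mk' 1).comp continuous_snd
  have hs : {x : Fin 2 → ℝ | ∀ i, x i ∈ Set.Ioc ((![u, v] i) / (2 * Real.pi))
      ((![u, v] i) / (2 * Real.pi) + 1)} = MeasurableEquiv.finTwoArrow ⁻¹'
      (Set.Ioc (u / (2 * Real.pi)) (u / (2 * Real.pi) + 1) ×ˢ
        Set.Ioc (v / (2 * Real.pi)) (v / (2 * Real.pi) + 1)) := by
    ext x
    simp [Fin.forall_fin_two]
  have e := UnitAddTorus.integral_preimage F (fun i => ![u, v] i / (2 * Real.pi))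
  have e2 : (fun x : Fin 2 → ℝ => F fun i => (x i : UnitAddCircle)) =
      fun x => G (MeasurableEquiv.finTwoArrow x) := by
    funext x
    simp only [G]
    congr 1
    funext i
    fin_cases i <;> rfl
  have hsc : ∀ (w : ℝ) (g : ℝ → ℂ), ∫ a in w / (2 * Real.pi)..w / (2 * Real.pi) + 1, g a =
      (2 * Real.pi : ℂ)⁻¹ * ∫ a in w..w + 2 * Real.pi, g (a / (2 * Real.pi)) := by
    intro w g
    rw [intervalIntegral.integral_comp_div _ hpi, add_div, div_self hpi, Complex.real_smul,
      Complex.ofReal_mul, Complex.ofReal_ofNat, inv_mul_cancel_left₀ (by exact_mod_cast hpi)]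
  have hGF : ∀ a b : ℝ, G (a / (2 * Real.pi), b / (2 * Real.pi)) = F (torusPoint ![a, b]) := by
    intro a b
    simp only [G]
    congr 1
    funext i
    fin_cases i <;> rfl
  refine e.trans ?_
  rw [hs, e2, (volume_preserving_finTwoArrow ℝ).setIntegral_preimage_emb
    MeasurableEquiv.finTwoArrow.measurableEmbedding, Measure.volume_eq_prod, setIntegral_prod]
  · rw [← intervalIntegral.integral_of_le (by linarith)]
    simp_rw [← intervalIntegral.integral_of_le (show v / (2 * Real.pi) ≤ v / (2 * Real.pi) + 1 by
      linarith), hsc, intervalIntegral.integral_const_mul]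
    rw [pow_two, mul_assoc]
    simp only [hGF]
  · rw [← Measure.volume_eq_prod]
    exact (hG.continuousOn.integrableOn_compact
      (isCompact_Icc.prod isCompact_Icc)).mono_set
        (Set.prod_mono Set.Ioc_subset_Icc_self Set.Ioc_subset_Icc_self)

/-- The function `f` on the torus has partial derivative `g` with respect to the quasi-momentum
`k_j`. -/
def HasPartial (j : Fin 2) (f g : Torus → ℂ) : Prop :=
  ∀ k : Fin 2 → ℝ, HasDerivAt (fun s => f (torusPoint (Function.update k j s)))
    (g (torusPoint k)) (k j)

namespace HasPartial

variable {j : Fin 2} {f g f' g' : C(Torus, ℂ)}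

lemma add (hf : HasPartial j f f') (hg : HasPartial j g g') :
    HasPartial j (f + g : C(Torus, ℂ)) (f' + g' : C(Torus, ℂ)) := fun k => (hf k).add (hg k)

lemma sub (hf : HasPartial j f f') (hg : HasPartial j g g') :
    HasPartial j (f - g : C(Torus, ℂ)) (f' - g' : C(Torus, ℂ)) := fun k => (hf k).sub (hg k)

lemma neg (hf : HasPartial j f f') :
    HasPartial j (-f : C(Torus, ℂ)) (-f' : C(Torus, ℂ)) := fun k => (hf k).neg

lemma smul (c : ℂ) (hf : HasPartial j f f') :
    HasPartial j (c • f : C(Torus, ℂ)) (c • f' : C(Torus, ℂ)) := fun k => (hf k).const_smul c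

lemma mul (hf : HasPartial j f f') (hg : HasPartial j g g') :
    HasPartial j (f * g : C(Torus, ℂ)) (f' * g + f * g' : C(Torus, ℂ)) := fun k => by
  have := (hf k).mul (hg k)
  simp only [Function.update_eq_self] at this
  exact this

lemma one : HasPartial j (1 : C(Torus, ℂ)) (0 : C(Torus, ℂ)) := fun k =>
  hasDerivAt_const (k j) (1 : ℂ)

end HasPartial

/-- A partial derivative has mean zero over the torus. -/
lemma HasPartial.integral_eq_zero {j : Fin 2} {f g : C(Torus, ℂ)} (h : HasPartial j f g) :
    ∫ t : Torus, g t = 0 := by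
  have hin : ∀ k : Fin 2 → ℝ,
      ∫ s in (0 : ℝ)..0 + 2 * Real.pi, g (torusPoint (Function.update k j s)) = 0 := by
    intro k
    rw [intervalIntegral.integral_eq_sub_of_hasDerivAt
      (f := fun s => f (torusPoint (Function.update k j s)))]
    · simp only [torusPoint_update_add, sub_self]
    · intro s _
      have := h (Function.update k j s)
      simpa using this
    · exact (g.continuous.comp (continuous_torusPoint.comp
        (continuous_const.update j continuous_id))).intervalIntegrable _ _
  rw [integral_torus_eq g.continuous 0 0]
  refine mul_eq_zero_of_right _ ?_
  obtain rfl | rfl : j = 0 ∨ j = 1 := by fin_cases j <;> simp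
  · rw [intervalIntegral_intervalIntegral_swap]
    · have : ∀ b a : ℝ, torusPoint ![a, b] = torusPoint (Function.update ![0, b] 0 a) := by
        intro b a; congr 1; funext i; fin_cases i <;> rfl
      simp only [this, hin, intervalIntegral.integral_zero]
    · have : Continuous (fun p : ℝ × ℝ => g (torusPoint ![p.1, p.2])) :=
        g.continuous.comp (continuous_torusPoint.comp (by fun_prop))
      exact (this.continuousOn.integrableOn_compact (isCompact_uIcc.prod isCompact_uIcc)).mono_set
        (Set.prod_mono Set.uIoc_subset_uIcc Set.uIoc_subset_uIcc)
  · have : ∀ a b : ℝ, torusPoint ![a, b] = torusPoint (Function.update ![a, 0] 1 b) := by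
      intro a b; congr 1; funext i; fin_cases i <;> rfl
    simp only [this, hin, intervalIntegral.integral_zero]

lemma hasPartial_mFourier (j : Fin 2) (n : Site) :
    HasPartial j (mFourier n : C(Torus, ℂ)) ((Complex.I * n j) • mFourier n : C(Torus, ℂ)) := by
  intro k
  have hm : ∀ k : Fin 2 → ℝ, mFourier n (torusPoint k) =
      Complex.exp (Complex.I * (n 0 * k 0 + n 1 * k 1)) := by
    intro k
    have hpi : (Real.pi : ℂ) ≠ 0 := by exact_mod_cast Real.pi_ne_zero
    change ∏ i, _root_.fourier (n i) (torusPoint k i) = _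
    simp only [torusPoint, fourier_coe_apply, Fin.prod_univ_two, ← Complex.exp_add]
    congr 1
    push_cast
    field_simp
  simp only [hm, ContinuousMap.smul_apply, smul_eq_mul]
  have hd : HasDerivAt (fun s : ℝ => Complex.I *
      ((n 0 : ℂ) * ((Function.update k j s) 0 : ℝ) + n 1 * ((Function.update k j s) 1 : ℝ)))
      (Complex.I * n j) (k j) := by
    have hid := (hasDerivAt_id (k j)).ofReal_comp
    fin_cases j
    · simpa using ((hid.const_mul (n 0 : ℂ)).add_const _).const_mul Complex.I
    · simpa using ((hid.const_mul (n 1 : ℂ)).const_add _).const_mul Complex.I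
  have := hd.cexp
  simp only [Function.update_eq_self] at this
  rwa [mul_comm]

lemma HasPartial.mFourierCoeff_eq {j : Fin 2} {f g : C(Torus, ℂ)} (h : HasPartial j f g)
    (n : Site) : mFourierCoeff g n = Complex.I * n j * mFourierCoeff f n := by
  have h0 := (h.mul (hasPartial_mFourier j (-n))).integral_eq_zero
  have hi : ∀ f : C(Torus, ℂ), Integrable (fun t => f t) (volume : Measure Torus) := fun f =>
    f.continuous.integrable_of_hasCompactSupport (HasCompactSupport.of_compactSpace _)
  simp only [ContinuousMap.add_apply] at h0
  rw [integral_add (hi _) (hi _), add_eq_zero_iff_eq_neg, ← integral_neg] at h0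
  unfold mFourierCoeff
  rw [← integral_const_mul]
  refine Eq.trans (integral_congr_ae (.of_forall fun t => ?_)) (h0.trans
    (integral_congr_ae (.of_forall fun t => ?_)))
  · simp [mul_comm]
  · simp
    ring

/-! ### Commutators with the position operator -/

/-- The commutator `[X_j, A]` of a translation-invariant operator has symbol `-i ∂_j A`. -/
lemma isPositionCommutator_symbolOp (j : Fin 2) {A A' : Matrix (Fin 2) (Fin 2) C(Torus, ℂ)}
    (h : ∀ a b, HasPartial j (A a b) (A' a b)) :
    IsPositionCommutator j (symbolOp A) (symbolOp ((-Complex.I) • A')) := by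
  intro ψ
  have hmul : ∀ a b (x : Site),
      (x j : ℂ) * (mFourierBasis (d := Fin 2)).repr
        (multiplication volume (A a b) (component b ψ)) x =
      (mFourierBasis (d := Fin 2)).repr
        (multiplication volume (A a b) (component b (position j ψ))) x +
      (mFourierBasis (d := Fin 2)).repr
        (multiplication volume (((-Complex.I) • A') a b) (component b ψ)) x := by
    intro a b x
    have h1 := (hasSum_repr_multiplication (A a b) b ψ x).mul_left (x j : ℂ)
    have h2 := (hasSum_repr_multiplication (A a b) b (position j ψ) x).add
      (hasSum_repr_multiplication (((-Complex.I) • A') a b) b ψ x)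
    refine h1.unique (h2.congr_fun fun y => ?_)
    have e1 : mFourierCoeff (((-Complex.I) • A') a b) (x - y) =
        -Complex.I * mFourierCoeff (A' a b) (x - y) := by
      simp only [mFourierCoeff]
      rw [← integral_const_mul]
      refine integral_congr_ae (.of_forall fun t => ?_)
      simp
      ring
    have e2 : position j ψ y b = (y j : ℂ) * (ψ : Hilb) y b := rfl
    rw [e1, e2, (h a b).mFourierCoeff_eq]
    simp only [Pi.sub_apply, Int.cast_sub]
    linear_combination (((x j : ℂ) - y j) * mFourierCoeff (A a b) (x - y) * (ψ : Hilb) y b) *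
      Complex.I_sq
  have key : (fun x : Site => (x j : ℂ) • symbolOp A ψ x) =
      ((symbolOp A (position j ψ) + symbolOp ((-Complex.I) • A') ψ : Hilb) : Site → Spinor) := by
    funext x
    ext a
    rw [lp.coeFn_add, Pi.add_apply, PiLp.add_apply, PiLp.smul_apply, smul_eq_mul]
    simp only [symbolOp_apply]
    rw [Finset.mul_sum, ← Finset.sum_add_distrib]
    exact Finset.sum_congr rfl fun b _ => hmul a b x
  -- the right-hand side of `key` is square-summable, so `symbolOp A` preserves the domain of `X_j`
  have hmem : symbolOp A ψ ∈ (position j).domain := by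
    have h2 := lp.memℓp (symbolOp A (position j ψ) + symbolOp ((-Complex.I) • A') ψ : Hilb)
    rw [← key] at h2
    exact h2
  refine ⟨hmem, ?_⟩
  rw [sub_eq_iff_eq_add']
  exact Subtype.ext key

/-! ### Spectral projections of gapped operators -/

/-- If `H` is self-adjoint and `K` is positive and invertible with `K² = H²`, then `K = |H|`. So `H` is
invertible, and its spectral projection onto the negative half-line is `(1 - H |H|⁻¹) / 2`. -/
lemma fermiProjection_eq {E : Type*} [NormedAddCommGroup E] [InnerProductSpace ℂ E]
    [CompleteSpace E] {H K J : E →L[ℂ] E} (hH : IsSelfAdjoint H) (hK : 0 ≤ K)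
    (hKH : K * K = H * H) (hKJ : K * J = 1) (hJK : J * K = 1) :
    (0 : ℂ) ∉ spectrum ℂ H ∧ fermiProjection H = (1 / 2 : ℂ) • (1 - H * J) := by
  have hunit : IsUnit H := by
    refine isUnit_iff_exists_and_exists.mpr ⟨⟨H * (J * J), ?_⟩, ⟨J * J * H, ?_⟩⟩
    · rw [← mul_assoc, ← hKH, mul_assoc, ← mul_assoc K J J, hKJ, one_mul, hKJ]
    · rw [mul_assoc, ← hKH, mul_assoc, ← mul_assoc J K K, hJK, one_mul, hJK]
  have h0 : ∀ x ∈ spectrum ℝ H, x ≠ 0 := by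
    rintro x hx rfl
    exact spectrum.zero_notMem ℝ hunit hx
  refine ⟨spectrum.zero_notMem ℂ hunit, ?_⟩
  have habs : cfc (fun x : ℝ => ‖x‖) H = K := by
    rw [← CFC.abs_eq_cfc_norm H hH, CFC.abs, hH.star_eq]
    exact CFC.sqrt_unique hKH hK
  have hsc : ContinuousOn (fun x : ℝ => x / ‖x‖) (spectrum ℝ H) :=
    continuousOn_id.div continuous_norm.continuousOn fun x hx => norm_ne_zero_iff.mpr (h0 x hx)
  have hsign : cfc (fun x : ℝ => x / ‖x‖) H = H * J := by
    have h1 : cfc (fun x : ℝ => x / ‖x‖) H * K = H := by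
      rw [← habs, ← cfc_mul _ _ H hsc continuous_norm.continuousOn]
      refine Eq.trans (cfc_congr fun x hx => ?_) (cfc_id' ℝ H)
      exact div_mul_cancel₀ x (norm_ne_zero_iff.mpr (h0 x hx))
    calc cfc (fun x : ℝ => x / ‖x‖) H = cfc (fun x : ℝ => x / ‖x‖) H * K * J := by
          rw [mul_assoc, hKJ, mul_one]
      _ = H * J := by rw [h1]
  rw [fermiProjection, ← hsign]
  have hind : cfc (Set.indicator (Set.Iic (0 : ℝ)) fun _ => (1 : ℝ)) H =
      cfc (fun x : ℝ => (1 / 2 : ℝ) • ((1 : ℝ) - x / ‖x‖)) H := by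
    refine cfc_congr fun x hx => ?_
    rcases lt_or_gt_of_ne (h0 x hx) with h | h
    · simp only [Set.indicator, Set.mem_Iic, h.le, if_true, Real.norm_eq_abs, abs_of_neg h, smul_eq_mul]
      rw [div_neg, div_self h.ne]
      norm_num
    · simp only [Set.indicator, Set.mem_Iic, not_le.mpr h, if_false, Real.norm_eq_abs, abs_of_pos h,
        smul_eq_mul]
      rw [div_self h.ne']
      norm_num
  have hsmul : cfc (fun x : ℝ => (1 / 2 : ℝ) • ((1 : ℝ) - x / ‖x‖)) H =
      (1 / 2 : ℝ) • cfc (fun x : ℝ => (1 : ℝ) - x / ‖x‖) H :=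
    cfc_smul (1 / 2 : ℝ) (fun x : ℝ => (1 : ℝ) - x / ‖x‖) H (continuousOn_const.sub hsc)
  have hsub : cfc (fun x : ℝ => (1 : ℝ) - x / ‖x‖) H =
      cfc (fun _ : ℝ => (1 : ℝ)) H - cfc (fun x : ℝ => x / ‖x‖) H :=
    cfc_sub (fun _ : ℝ => (1 : ℝ)) (fun x : ℝ => x / ‖x‖) H continuousOn_const hsc
  rw [hind, hsmul, hsub, cfc_const_one ℝ H]
  ext ψ
  rw [smul_apply, smul_apply, ← Complex.coe_smul]
  norm_num

/-! ### Periodic functions of the quasi-momentum as symbols -/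

/-- A continuous real function of the quasi-momentum that is `2π`-periodic in both variables. -/
structure IsTorusFunction (f : (Fin 2 → ℝ) → ℝ) : Prop where
  continuous : Continuous f
  periodic : ∀ k j, f (k + Pi.single j (2 * Real.pi)) = f k

lemma isQuotientMap_torusPoint : Topology.IsQuotientMap torusPoint := by
  have h1 : IsOpenQuotientMap (fun x : ℝ => ((x / (2 * Real.pi) : ℝ) : UnitAddCircle)) :=
    (QuotientAddGroup.isOpenQuotientMap_mk).comp
      (Homeomorph.mulRight₀ (2 * Real.pi)⁻¹ (by positivity)).isOpenQuotientMap
  exact (IsOpenQuotientMap.piMap fun _ : Fin 2 => h1).isQuotientMap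

namespace IsTorusFunction

variable {f g : (Fin 2 → ℝ) → ℝ}

lemma eq_of_torusPoint_eq (hf : IsTorusFunction f) {k k' : Fin 2 → ℝ}
    (h : torusPoint k = torusPoint k') : f k = f k' := by
  have hn : ∀ j, ∃ n : ℤ, k j = k' j + n * (2 * Real.pi) := by
    intro j
    obtain ⟨n, hn⟩ := (QuotientAddGroup.eq_iff_sub_mem.mp (congrFun h j).symm)
    refine ⟨-n, ?_⟩
    have hpi : Real.pi ≠ 0 := Real.pi_ne_zero
    simp only [zsmul_eq_mul, mul_one] at hn
    push_cast
    rw [hn]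
    field_simp
    ring
  choose n hn using hn
  have hper : ∀ j (x : Fin 2 → ℝ) (m : ℤ), f (x + Pi.single j (m * (2 * Real.pi))) = f x := by
    intro j x m
    have hp : Function.Periodic (fun s : ℝ => f (x + Pi.single j s)) (2 * Real.pi) := by
      intro s
      simp only [Pi.single_add, ← add_assoc, hf.periodic]
    simpa using hp.int_mul m 0
  have hk : k = k' + Pi.single 0 (n 0 * (2 * Real.pi)) + Pi.single 1 (n 1 * (2 * Real.pi)) := by
    funext j
    rw [hn j]
    fin_cases j <;> simp
  rw [hk, hper, hper]

lemma add (hf : IsTorusFunction f) (hg : IsTorusFunction g) :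
    IsTorusFunction fun k => f k + g k :=
  ⟨hf.continuous.add hg.continuous, fun k j => by rw [hf.periodic, hg.periodic]⟩

lemma sub (hf : IsTorusFunction f) (hg : IsTorusFunction g) :
    IsTorusFunction fun k => f k - g k :=
  ⟨hf.continuous.sub hg.continuous, fun k j => by rw [hf.periodic, hg.periodic]⟩

lemma mul (hf : IsTorusFunction f) (hg : IsTorusFunction g) :
    IsTorusFunction fun k => f k * g k :=
  ⟨hf.continuous.mul hg.continuous, fun k j => by rw [hf.periodic, hg.periodic]⟩

lemma div (hf : IsTorusFunction f) (hg : IsTorusFunction g) (h0 : ∀ k, g k ≠ 0) :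
    IsTorusFunction fun k => f k / g k :=
  ⟨hf.continuous.div hg.continuous h0, fun k j => by rw [hf.periodic, hg.periodic]⟩

lemma pow (hf : IsTorusFunction f) (n : ℕ) : IsTorusFunction fun k => f k ^ n :=
  ⟨hf.continuous.pow n, fun k j => by rw [hf.periodic]⟩

lemma sqrt (hf : IsTorusFunction f) : IsTorusFunction fun k => Real.sqrt (f k) :=
  ⟨hf.continuous.sqrt, fun k j => by rw [hf.periodic]⟩

lemma const (c : ℝ) : IsTorusFunction fun _ => c := ⟨continuous_const, fun _ _ => rfl⟩

lemma cos (i : Fin 2) : IsTorusFunction fun k => Real.cos (k i) :=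
  ⟨by fun_prop, fun k j => by
    by_cases h : i = j
    · subst h; simp
    · simp [h]⟩

lemma sin (i : Fin 2) : IsTorusFunction fun k => Real.sin (k i) :=
  ⟨by fun_prop, fun k j => by
    by_cases h : i = j
    · subst h; simp
    · simp [h]⟩

end IsTorusFunction

open Classical in
/-- The function on the torus given by a continuous periodic function of the quasi-momentum (and zero
for other functions). -/
noncomputable def toTorus (f : (Fin 2 → ℝ) → ℝ) : C(Torus, ℂ) :=
  if h : IsTorusFunction f then
    Topology.IsQuotientMap.lift (f := ⟨torusPoint, continuous_torusPoint⟩)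
      isQuotientMap_torusPoint ⟨fun k => (f k : ℂ), Complex.continuous_ofReal.comp h.continuous⟩
      fun _ _ hk => congrArg Complex.ofReal (h.eq_of_torusPoint_eq hk)
  else 0

lemma toTorus_torusPoint {f : (Fin 2 → ℝ) → ℝ} (hf : IsTorusFunction f) (k : Fin 2 → ℝ) :
    toTorus f (torusPoint k) = f k := by
  rw [toTorus, dif_pos hf]
  exact DFunLike.congr_fun (Topology.IsQuotientMap.lift_comp
    (f := ⟨torusPoint, continuous_torusPoint⟩) isQuotientMap_torusPoint
    ⟨fun k => (f k : ℂ), Complex.continuous_ofReal.comp hf.continuous⟩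
    fun _ _ hk => congrArg Complex.ofReal (hf.eq_of_torusPoint_eq hk)) k

lemma ext_torusPoint {f g : C(Torus, ℂ)} (h : ∀ k, f (torusPoint k) = g (torusPoint k)) : f = g := by
  ext t
  obtain ⟨k, rfl⟩ := isQuotientMap_torusPoint.surjective t
  exact h k

lemma star_toTorus {f : (Fin 2 → ℝ) → ℝ} (hf : IsTorusFunction f) :
    star (toTorus f) = toTorus f :=
  ext_torusPoint fun k => by
    rw [ContinuousMap.star_apply, toTorus_torusPoint hf, RCLike.star_def, Complex.conj_ofReal]

lemma hasPartial_toTorus {j : Fin 2} {f g : (Fin 2 → ℝ) → ℝ} (hf : IsTorusFunction f)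
    (hg : IsTorusFunction g)
    (h : ∀ k, HasDerivAt (fun s => f (Function.update k j s)) (g k) (k j)) :
    HasPartial j (toTorus f) (toTorus g) := fun k => by
  simp only [toTorus_torusPoint hf, toTorus_torusPoint hg]
  exact (h k).ofReal_comp

/-! ### The Fermi projection of the `d ± i d` Hamiltonian -/

/-- The combination `v₁ σ₁ + v₂ σ₂ + v₃ σ₃` of the Pauli matrices. -/
noncomputable def pauli {R : Type*} [CommRing R] [Algebra ℂ R] (v₁ v₂ v₃ : R) :
    Matrix (Fin 2) (Fin 2) R :=
  !![v₃, v₁ - algebraMap ℂ R Complex.I * v₂; v₁ + algebraMap ℂ R Complex.I * v₂, -v₃]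

lemma pauli_mul_self {R : Type*} [CommRing R] [Algebra ℂ R] (v₁ v₂ v₃ : R) :
    pauli v₁ v₂ v₃ * pauli v₁ v₂ v₃ = Matrix.diagonal fun _ => v₁ ^ 2 + v₂ ^ 2 + v₃ ^ 2 := by
  have hI : algebraMap ℂ R Complex.I ^ 2 = -1 := by
    rw [← map_pow, Complex.I_sq, map_neg, map_one]
  ext a b
  fin_cases a <;> fin_cases b <;> simp [pauli, Matrix.mul_apply, Fin.sum_univ_two]
  · linear_combination (-v₂ ^ 2) * hI
  · ring
  · ring
  · linear_combination (-v₂ ^ 2) * hI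

lemma isTorusFunction_p₁ (δ : ℝ) : IsTorusFunction (p₁ δ) :=
  (IsTorusFunction.const δ).mul ((IsTorusFunction.cos 0).sub (IsTorusFunction.cos 1))

lemma isTorusFunction_p₂ (δ : ℝ) : IsTorusFunction (p₂ δ) :=
  (IsTorusFunction.const δ).mul ((IsTorusFunction.sin 0).mul (IsTorusFunction.sin 1))

lemma isTorusFunction_p₃ (μ : ℝ) : IsTorusFunction (p₃ μ) :=
  ((IsTorusFunction.cos 0).add (IsTorusFunction.cos 1)).sub (IsTorusFunction.const (μ / 2))

/-- The upper Bloch band `E₊(k) = |p(k)|`. -/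
noncomputable def energy (μ δ : ℝ) (k : Fin 2 → ℝ) : ℝ :=
  Real.sqrt (p₁ δ k ^ 2 + p₂ δ k ^ 2 + p₃ μ k ^ 2)

lemma isTorusFunction_energy (μ δ : ℝ) : IsTorusFunction (energy μ δ) :=
  ((((isTorusFunction_p₁ δ).pow 2).add ((isTorusFunction_p₂ δ).pow 2)).add
    ((isTorusFunction_p₃ μ).pow 2)).sqrt

/-- The identity `p₁² + p₂² = δ² (1 - cos k₁ cos k₂)²`. -/
lemma p₁_sq_add_p₂_sq (δ : ℝ) (k : Fin 2 → ℝ) :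
    p₁ δ k ^ 2 + p₂ δ k ^ 2 = δ ^ 2 * (1 - Real.cos (k 0) * Real.cos (k 1)) ^ 2 := by
  unfold p₁ p₂
  have h0 := Real.sin_sq_add_cos_sq (k 0)
  have h1 := Real.sin_sq_add_cos_sq (k 1)
  linear_combination δ ^ 2 * Real.sin (k 1) ^ 2 * h0 + δ ^ 2 * (1 - Real.cos (k 0) ^ 2) * h1

lemma energy_sq (μ δ : ℝ) (k : Fin 2 → ℝ) :
    energy μ δ k ^ 2 = p₁ δ k ^ 2 + p₂ δ k ^ 2 + p₃ μ k ^ 2 :=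
  Real.sq_sqrt (by positivity)

/-- Where `p₁ = p₂ = 0`, both cosines are `1` or both are `-1`. -/
lemma cos_eq_of_cos_mul_cos_eq_one {k : Fin 2 → ℝ} (h : 1 - Real.cos (k 0) * Real.cos (k 1) = 0) :
    (Real.cos (k 0) = 1 ∧ Real.cos (k 1) = 1) ∨ (Real.cos (k 0) = -1 ∧ Real.cos (k 1) = -1) := by
  have h0 := Real.sin_sq_add_cos_sq (k 0)
  have h1 := Real.sin_sq_add_cos_sq (k 1)
  have e : Real.cos (k 0) = Real.cos (k 1) := by
    nlinarith [sq_nonneg (Real.cos (k 0) - Real.cos (k 1)), sq_nonneg (Real.sin (k 0)),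
      sq_nonneg (Real.sin (k 1))]
  rw [← e] at h ⊢
  have : (Real.cos (k 0) - 1) * (Real.cos (k 0) + 1) = 0 := by linarith
  rcases mul_eq_zero.mp this with h | h
  · exact Or.inl ⟨by linarith, by linarith⟩
  · exact Or.inr ⟨by linarith, by linarith⟩

/-- The bands do not touch: `p₁` and `p₂` vanish simultaneously only where `cos k₁ = cos k₂ = ±1`, and
there `p₃ = ±2 - μ/2`. -/
lemma energy_pos {μ δ : ℝ} (hδ : δ ≠ 0) (hμ : |μ| ≠ 4) (k : Fin 2 → ℝ) : 0 < energy μ δ k := by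
  refine Real.sqrt_pos.mpr ?_
  rw [p₁_sq_add_p₂_sq]
  have hδ2 : 0 < δ ^ 2 := by positivity
  by_cases hw : 1 - Real.cos (k 0) * Real.cos (k 1) = 0
  · have hp : p₃ μ k ≠ 0 := by
      intro hp
      apply hμ
      rcases cos_eq_of_cos_mul_cos_eq_one hw with ⟨h0, h1⟩ | ⟨h0, h1⟩
      · have : μ = 4 := by rw [p₃, h0, h1] at hp; linarith
        rw [this]; norm_num
      · have : μ = -4 := by rw [p₃, h0, h1] at hp; linarith
        rw [this]; norm_num
    positivity
  · positivity

lemma shift_eq_symbolOp (j : Fin 2) :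
    shift j = symbolOp (Matrix.diagonal fun _ => mFourier (Pi.single j 1)) :=
  translation_eq_symbolOp _

lemma star_shift_eq_symbolOp (j : Fin 2) :
    star (shift j) = symbolOp (Matrix.diagonal fun _ => star (mFourier (Pi.single j 1))) := by
  rw [shift_eq_symbolOp, ← map_star, Matrix.star_eq_conjTranspose, Matrix.diagonal_conjTranspose]
  rfl

lemma mFourier_single_torusPoint (j : Fin 2) (k : Fin 2 → ℝ) :
    mFourier (Pi.single j 1) (torusPoint k) = Real.cos (k j) + Real.sin (k j) * Complex.I := by
  have hpi : (Real.pi : ℂ) ≠ 0 := by exact_mod_cast Real.pi_ne_zero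
  rw [mFourier_single, torusPoint, fourier_coe_apply, Complex.ofReal_cos, Complex.ofReal_sin,
    ← Complex.exp_mul_I]
  congr 1
  push_cast
  field_simp

/-- The symbol of the Hamiltonian. It is even in `k`, so the two sign conventions for the Fourier
transform agree. -/
lemma hamiltonian_eq_symbolOp (σ μ δ : ℝ) :
    hamiltonian σ μ δ = symbolOp (pauli (toTorus (p₁ δ))
      (toTorus fun k => σ * p₂ δ k) (toTorus (p₃ μ))) := by
  have e1 : (1 : Hilb →L[ℂ] Hilb) = symbolOp 1 := (map_one _).symm
  rw [hamiltonian]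
  simp only [star_shift_eq_symbolOp]
  simp only [fibreOp_eq_symbolOp, shift_eq_symbolOp, e1]
  simp only [← map_add, ← map_sub, ← map_mul, ← map_smul]
  congr 1
  refine Matrix.ext fun a b => ext_torusPoint fun k => ?_
  have h1 := toTorus_torusPoint (isTorusFunction_p₁ δ) k
  have h2 := toTorus_torusPoint ((IsTorusFunction.const σ).mul (isTorusFunction_p₂ δ)) k
  have h3 := toTorus_torusPoint (isTorusFunction_p₃ μ) k
  generalize toTorus (fun k => σ * p₂ δ k) = q₂ at h2 ⊢
  have hm := fun j => mFourier_single_torusPoint j k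
  fin_cases a <;> fin_cases b <;>
    simp [pauli, Matrix.mul_apply, Fin.sum_univ_two, h1, h2, h3, hm, p₁, p₂, p₃,
      Matrix.one_apply, -Complex.ofReal_cos, -Complex.ofReal_sin] <;> ring_nf <;>
    simp [-Complex.ofReal_cos, -Complex.ofReal_sin] <;> ring

section Fermi

variable {σ μ δ : ℝ}

/-- The symbol `(1 - n · σ) / 2` of the Fermi projection, where `n` is the direction of
`(p₁, σ p₂, p₃)`. -/
noncomputable def fermiSymbol (σ μ δ : ℝ) : Matrix (Fin 2) (Fin 2) C(Torus, ℂ) :=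
  (1 / 2 : ℂ) • (1 - pauli (toTorus fun k => p₁ δ k / energy μ δ k)
    (toTorus fun k => σ * p₂ δ k / energy μ δ k) (toTorus fun k => p₃ μ k / energy μ δ k))

lemma isSelfAdjoint_hamiltonian (σ μ δ : ℝ) : IsSelfAdjoint (hamiltonian σ μ δ) := by
  rw [IsSelfAdjoint, hamiltonian_eq_symbolOp, ← map_star]
  congr 1
  have h1 := star_toTorus (isTorusFunction_p₁ δ)
  have h2 := star_toTorus ((IsTorusFunction.const σ).mul (isTorusFunction_p₂ δ))
  have h3 := star_toTorus (isTorusFunction_p₃ μ)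
  have hI : star (algebraMap ℂ C(Torus, ℂ) Complex.I) = -algebraMap ℂ C(Torus, ℂ) Complex.I := by
    rw [← map_neg, ← Complex.conj_I]
    exact (algebraMap_star_comm _).symm
  ext1 a b
  rw [Matrix.star_apply]
  fin_cases a <;> fin_cases b <;> simp [pauli, h1, h2, h3, hI, sub_eq_add_neg] <;>
    ring

lemma isTorusFunction_div_energy (hδ : δ ≠ 0) (hμ : |μ| ≠ 4) {f : (Fin 2 → ℝ) → ℝ}
    (hf : IsTorusFunction f) : IsTorusFunction fun k => f k / energy μ δ k :=
  hf.div (isTorusFunction_energy μ δ) fun k => (energy_pos hδ hμ k).ne'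

/-- `H²` is multiplication by the square of the band energy, so `|H|` has symbol `E₊`. -/
lemma spectrum_and_fermiProjection (hσ : σ = 1 ∨ σ = -1) (hδ : δ ≠ 0) (hμ : |μ| ≠ 4) :
    (0 : ℂ) ∉ spectrum ℂ (hamiltonian σ μ δ) ∧
      fermiProjection (hamiltonian σ μ δ) = symbolOp (fermiSymbol σ μ δ) := by
  have hE := isTorusFunction_energy μ δ
  have hE0 := energy_pos hδ hμ
  have hJ := isTorusFunction_div_energy hδ hμ (IsTorusFunction.const 1)
  have h1 := isTorusFunction_p₁ δ
  have h2 := (IsTorusFunction.const σ).mul (isTorusFunction_p₂ δ)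
  have h3 := isTorusFunction_p₃ μ
  have hσ2 : σ ^ 2 = 1 := by rcases hσ with rfl | rfl <;> norm_num
  have hEJ : toTorus (energy μ δ) * toTorus (fun k => 1 / energy μ δ k) = 1 :=
    ext_torusPoint fun k => by
      have : (energy μ δ k : ℂ) ≠ 0 := by exact_mod_cast (hE0 k).ne'
      rw [ContinuousMap.mul_apply, toTorus_torusPoint hE, toTorus_torusPoint hJ,
        ContinuousMap.one_apply]
      push_cast
      field_simp
  have hdiv : ∀ {f : (Fin 2 → ℝ) → ℝ}, IsTorusFunction f →
      toTorus f * toTorus (fun k => 1 / energy μ δ k) = toTorus fun k => f k / energy μ δ k :=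
    fun {f} hf => ext_torusPoint fun k => by
      rw [ContinuousMap.mul_apply, toTorus_torusPoint hf, toTorus_torusPoint hJ,
        toTorus_torusPoint (isTorusFunction_div_energy hδ hμ hf)]
      push_cast
      ring
  have hdiag : ∀ f g : C(Torus, ℂ), symbolOp (Matrix.diagonal fun _ => f) *
      symbolOp (Matrix.diagonal fun _ => g) = symbolOp (Matrix.diagonal fun _ => f * g) :=
    fun f g => by rw [← map_mul, Matrix.diagonal_mul_diagonal]
  have hone : symbolOp (Matrix.diagonal fun _ => (1 : C(Torus, ℂ))) = 1 := by
    rw [Matrix.diagonal_one, map_one]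
  have key := fermiProjection_eq (isSelfAdjoint_hamiltonian σ μ δ)
    (K := symbolOp (Matrix.diagonal fun _ => toTorus (energy μ δ)))
    (J := symbolOp (Matrix.diagonal fun _ => toTorus fun k => 1 / energy μ δ k))
    ?_ ?_ (by rw [hdiag, hEJ, hone]) (by rw [hdiag, mul_comm, hEJ, hone])
  · refine ⟨key.1, key.2.trans ?_⟩
    rw [hamiltonian_eq_symbolOp, ← map_mul, ← map_one symbolOp, ← map_sub, ← map_smul, fermiSymbol]
    congr 3
    ext1 a b
    rw [Matrix.mul_diagonal]
    rw [← hdiv h1, ← hdiv h2, ← hdiv h3]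
    fin_cases a <;> fin_cases b <;> simp [pauli] <;> ring
  · have hs : symbolOp (Matrix.diagonal fun _ => toTorus (energy μ δ)) =
        star (symbolOp (Matrix.diagonal fun _ => toTorus fun k => Real.sqrt (energy μ δ k))) *
          symbolOp (Matrix.diagonal fun _ => toTorus fun k => Real.sqrt (energy μ δ k)) := by
      rw [← map_star, Matrix.star_eq_conjTranspose, Matrix.diagonal_conjTranspose]
      simp only [Pi.star_def, star_toTorus hE.sqrt, hdiag]
      congr 3
      funext _
      refine ext_torusPoint fun k => ?_
      rw [ContinuousMap.mul_apply, toTorus_torusPoint hE, toTorus_torusPoint hE.sqrt,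
        ← Complex.ofReal_mul, Real.mul_self_sqrt (hE0 k).le]
    rw [hs]
    exact star_mul_self_nonneg _
  · rw [hdiag, hamiltonian_eq_symbolOp, ← map_mul, pauli_mul_self]
    congr 3
    funext _
    refine ext_torusPoint fun k => ?_
    simp only [ContinuousMap.mul_apply, ContinuousMap.add_apply, ContinuousMap.pow_apply]
    rw [toTorus_torusPoint hE, toTorus_torusPoint h1, toTorus_torusPoint h2, toTorus_torusPoint h3,
      ← pow_two]
    have : energy μ δ k ^ 2 = p₁ δ k ^ 2 + (σ * p₂ δ k) ^ 2 + p₃ μ k ^ 2 := by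
      rw [energy_sq, mul_pow, hσ2, one_mul]
    exact_mod_cast this

/-! ### The Berry curvature -/

/-- The partial derivative of `p₁` with respect to `k_j`. -/
noncomputable def dp₁ (δ : ℝ) (j : Fin 2) (k : Fin 2 → ℝ) : ℝ :=
  δ * (![-Real.sin (k 0), Real.sin (k 1)] j)

/-- The partial derivative of `p₂` with respect to `k_j`. -/
noncomputable def dp₂ (δ : ℝ) (j : Fin 2) (k : Fin 2 → ℝ) : ℝ :=
  δ * (![Real.cos (k 0) * Real.sin (k 1), Real.sin (k 0) * Real.cos (k 1)] j)

/-- The partial derivative of `p₃` with respect to `k_j`. -/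
noncomputable def dp₃ (j : Fin 2) (k : Fin 2 → ℝ) : ℝ := -Real.sin (k j)

/-- The partial derivative of the energy with respect to `k_j`. -/
noncomputable def dEnergy (μ δ : ℝ) (j : Fin 2) (k : Fin 2 → ℝ) : ℝ :=
  (p₁ δ k * dp₁ δ j k + p₂ δ k * dp₂ δ j k + p₃ μ k * dp₃ j k) / energy μ δ k

/-- The partial derivative of `f / E`, where `f'` is that of `f`. -/
noncomputable def dDiv (μ δ : ℝ) (j : Fin 2) (f f' : (Fin 2 → ℝ) → ℝ) (k : Fin 2 → ℝ) : ℝ :=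
  (f' k * energy μ δ k - f k * dEnergy μ δ j k) / energy μ δ k ^ 2

lemma hasDerivAt_p₁ (δ : ℝ) (j : Fin 2) (k : Fin 2 → ℝ) :
    HasDerivAt (fun s => p₁ δ (Function.update k j s)) (dp₁ δ j k) (k j) := by
  unfold p₁ dp₁
  fin_cases j
  · simpa using ((Real.hasDerivAt_cos (k 0)).sub_const (Real.cos (k 1))).const_mul δ
  · simpa using ((Real.hasDerivAt_cos (k 1)).const_sub (Real.cos (k 0))).const_mul δ

lemma hasDerivAt_p₂ (δ : ℝ) (j : Fin 2) (k : Fin 2 → ℝ) :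
    HasDerivAt (fun s => p₂ δ (Function.update k j s)) (dp₂ δ j k) (k j) := by
  unfold p₂ dp₂
  fin_cases j
  · simpa using ((Real.hasDerivAt_sin (k 0)).mul_const (Real.sin (k 1))).const_mul δ
  · simpa using ((Real.hasDerivAt_sin (k 1)).const_mul (Real.sin (k 0))).const_mul δ

lemma hasDerivAt_p₃ (μ : ℝ) (j : Fin 2) (k : Fin 2 → ℝ) :
    HasDerivAt (fun s => p₃ μ (Function.update k j s)) (dp₃ j k) (k j) := by
  unfold p₃ dp₃
  fin_cases j
  · simpa using ((Real.hasDerivAt_cos (k 0)).add_const (Real.cos (k 1))).sub_const (μ / 2)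
  · simpa using ((Real.hasDerivAt_cos (k 1)).const_add (Real.cos (k 0))).sub_const (μ / 2)

lemma hasDerivAt_energy (hδ : δ ≠ 0) (hμ : |μ| ≠ 4) (j : Fin 2) (k : Fin 2 → ℝ) :
    HasDerivAt (fun s => energy μ δ (Function.update k j s)) (dEnergy μ δ j k) (k j) := by
  have h := ((((hasDerivAt_p₁ δ j k).pow 2).add ((hasDerivAt_p₂ δ j k).pow 2)).add
    ((hasDerivAt_p₃ μ j k).pow 2)).sqrt (by
      have := (energy_pos hδ hμ k).ne'
      rw [energy, Real.sqrt_ne_zero'] at this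
      simpa using this.ne')
  refine h.congr_deriv ?_
  have hE := (energy_pos hδ hμ k).ne'
  simp only [Pi.add_apply, Pi.pow_apply, Function.update_eq_self, dEnergy]
  change _ / (2 * energy μ δ k) = _
  field_simp
  ring

lemma hasDerivAt_div_energy (hδ : δ ≠ 0) (hμ : |μ| ≠ 4) {j : Fin 2} {f f' : (Fin 2 → ℝ) → ℝ}
    (hf : ∀ k, HasDerivAt (fun s => f (Function.update k j s)) (f' k) (k j)) (k : Fin 2 → ℝ) :
    HasDerivAt (fun s => f (Function.update k j s) / energy μ δ (Function.update k j s))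
      (dDiv μ δ j f f' k) (k j) := by
  have := (hf k).div (hasDerivAt_energy hδ hμ j k)
    (by simpa using (energy_pos hδ hμ k).ne')
  simp only [Function.update_eq_self] at this
  exact this

lemma isTorusFunction_dp₁ (δ : ℝ) (j : Fin 2) : IsTorusFunction (dp₁ δ j) := by
  refine (IsTorusFunction.const δ).mul ?_
  fin_cases j
  · simpa using (IsTorusFunction.const 0).sub (IsTorusFunction.sin 0)
  · simpa using IsTorusFunction.sin 1

lemma isTorusFunction_dp₂ (δ : ℝ) (j : Fin 2) : IsTorusFunction (dp₂ δ j) := by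
  refine (IsTorusFunction.const δ).mul ?_
  fin_cases j
  · exact (IsTorusFunction.cos 0).mul (IsTorusFunction.sin 1)
  · exact (IsTorusFunction.sin 0).mul (IsTorusFunction.cos 1)

lemma isTorusFunction_dp₃ (j : Fin 2) : IsTorusFunction (dp₃ j) := by
  unfold dp₃
  simpa using (IsTorusFunction.const 0).sub (IsTorusFunction.sin j)

lemma isTorusFunction_dDiv (hδ : δ ≠ 0) (hμ : |μ| ≠ 4) {j : Fin 2} {f f' : (Fin 2 → ℝ) → ℝ}
    (hf : IsTorusFunction f) (hf' : IsTorusFunction f') : IsTorusFunction (dDiv μ δ j f f') := by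
  have hE := isTorusFunction_energy μ δ
  have hdE : IsTorusFunction (dEnergy μ δ j) := isTorusFunction_div_energy hδ hμ
    ((((isTorusFunction_p₁ δ).mul (isTorusFunction_dp₁ δ j)).add
      ((isTorusFunction_p₂ δ).mul (isTorusFunction_dp₂ δ j))).add
      ((isTorusFunction_p₃ μ).mul (isTorusFunction_dp₃ j)))
  exact ((hf'.mul hE).sub (hf.mul hdE)).div (hE.pow 2) fun k => (pow_pos (energy_pos hδ hμ k) 2).ne'

lemma hasPartial_pauli {j : Fin 2} {v₁ v₂ v₃ w₁ w₂ w₃ : C(Torus, ℂ)} (h₁ : HasPartial j v₁ w₁)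
    (h₂ : HasPartial j v₂ w₂) (h₃ : HasPartial j v₃ w₃) (a b : Fin 2) :
    HasPartial j (pauli v₁ v₂ v₃ a b : C(Torus, ℂ)) (pauli w₁ w₂ w₃ a b : C(Torus, ℂ)) := by
  simp only [pauli, ← Algebra.smul_def]
  fin_cases a <;> fin_cases b
  · exact h₃
  · exact h₁.sub (h₂.smul _)
  · exact h₁.add (h₂.smul _)
  · exact h₃.neg

/-- The symbol of `∂_j` of the Fermi projection. -/
noncomputable def dFermiSymbol (σ μ δ : ℝ) (j : Fin 2) : Matrix (Fin 2) (Fin 2) C(Torus, ℂ) :=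
  (-(1 / 2) : ℂ) • pauli (toTorus (dDiv μ δ j (p₁ δ) (dp₁ δ j)))
    (toTorus (dDiv μ δ j (fun k => σ * p₂ δ k) fun k => σ * dp₂ δ j k))
    (toTorus (dDiv μ δ j (p₃ μ) (dp₃ j)))

lemma hasPartial_fermiSymbol (hδ : δ ≠ 0) (hμ : |μ| ≠ 4) (j a b : Fin 2) :
    HasPartial j (fermiSymbol σ μ δ a b) (dFermiSymbol σ μ δ j a b) := by
  have h₂ := (IsTorusFunction.const σ).mul (isTorusFunction_p₂ δ)
  have h := hasPartial_pauli
    (hasPartial_toTorus (isTorusFunction_div_energy hδ hμ (isTorusFunction_p₁ δ))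
      (isTorusFunction_dDiv hδ hμ (isTorusFunction_p₁ δ) (isTorusFunction_dp₁ δ j))
      (hasDerivAt_div_energy hδ hμ fun k => hasDerivAt_p₁ δ j k))
    (hasPartial_toTorus (isTorusFunction_div_energy hδ hμ h₂)
      (isTorusFunction_dDiv hδ hμ h₂ ((IsTorusFunction.const σ).mul (isTorusFunction_dp₂ δ j)))
      (hasDerivAt_div_energy hδ hμ (f := fun k => σ * p₂ δ k)
        fun k => (hasDerivAt_p₂ δ j k).const_mul σ))
    (hasPartial_toTorus (isTorusFunction_div_energy hδ hμ (isTorusFunction_p₃ μ))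
      (isTorusFunction_dDiv hδ hμ (isTorusFunction_p₃ μ) (isTorusFunction_dp₃ j))
      (hasDerivAt_div_energy hδ hμ fun k => hasDerivAt_p₃ μ j k)) a b
  have h1 : HasPartial j ((1 : Matrix (Fin 2) (Fin 2) C(Torus, ℂ)) a b) (0 : C(Torus, ℂ)) := by
    rw [Matrix.one_apply]
    split_ifs
    · exact HasPartial.one
    · exact fun k => hasDerivAt_const (k j) (0 : ℂ)
  have := (h1.sub h).smul (1 / 2)
  have e : (1 / 2 : ℂ) • (0 - pauli (toTorus (dDiv μ δ j (p₁ δ) (dp₁ δ j)))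
      (toTorus (dDiv μ δ j (fun k => σ * p₂ δ k) fun k => σ * dp₂ δ j k))
      (toTorus (dDiv μ δ j (p₃ μ) (dp₃ j))) a b) = dFermiSymbol σ μ δ j a b := by
    rw [dFermiSymbol, Matrix.smul_apply, zero_sub, smul_neg]
    exact (neg_smul _ _).symm
  rw [e] at this
  exact this

/-- The curvature `n · (∂₁n × ∂₂n)` of the direction `n` of `(p₁, σ p₂, p₃)`, in closed form; see
`curvature_eq_det`. -/
noncomputable def curvature (σ μ δ : ℝ) (k : Fin 2 → ℝ) : ℝ :=
  σ * δ ^ 2 * (1 - Real.cos (k 0) * Real.cos (k 1)) *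
    (-(Real.sin (k 0) ^ 2 + Real.sin (k 1) ^ 2) -
      p₃ μ k * (Real.cos (k 0) + Real.cos (k 1))) / energy μ δ k ^ 3

lemma isTorusFunction_curvature (hδ : δ ≠ 0) (hμ : |μ| ≠ 4) :
    IsTorusFunction (curvature σ μ δ) := by
  have hc := IsTorusFunction.cos
  have hs := IsTorusFunction.sin
  have h : IsTorusFunction fun k : Fin 2 → ℝ => σ * δ ^ 2 *
      (1 - Real.cos (k 0) * Real.cos (k 1)) *
      ((0 - (Real.sin (k 0) ^ 2 + Real.sin (k 1) ^ 2)) -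
      p₃ μ k * (Real.cos (k 0) + Real.cos (k 1))) / energy μ δ k ^ 3 :=
    (((IsTorusFunction.const _).mul ((IsTorusFunction.const 1).sub ((hc 0).mul (hc 1)))).mul
      (((IsTorusFunction.const 0).sub (((hs 0).pow 2).add ((hs 1).pow 2))).sub
        ((isTorusFunction_p₃ μ).mul ((hc 0).add (hc 1))))).div
      ((isTorusFunction_energy μ δ).pow 3) fun k => (pow_pos (energy_pos hδ hμ k) 3).ne'
  simp only [zero_sub] at h
  exact h

/-- The triple product does not see the derivative of the length of `(p₁, σ p₂, p₃)`, so it is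
`det (p, ∂₁p, ∂₂p) / E³`. -/
lemma curvature_eq_det (hδ : δ ≠ 0) (hμ : |μ| ≠ 4) (k : Fin 2 → ℝ) :
    !![p₁ δ k / energy μ δ k, σ * p₂ δ k / energy μ δ k, p₃ μ k / energy μ δ k;
      dDiv μ δ 0 (p₁ δ) (dp₁ δ 0) k,
      dDiv μ δ 0 (fun k => σ * p₂ δ k) (fun k => σ * dp₂ δ 0 k) k, dDiv μ δ 0 (p₃ μ) (dp₃ 0) k;
      dDiv μ δ 1 (p₁ δ) (dp₁ δ 1) k,
      dDiv μ δ 1 (fun k => σ * p₂ δ k) (fun k => σ * dp₂ δ 1 k) k,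
      dDiv μ δ 1 (p₃ μ) (dp₃ 1) k].det = curvature σ μ δ k := by
  have hE := (energy_pos hδ hμ k).ne'
  have h0 := Real.sin_sq_add_cos_sq (k 0)
  have h1 := Real.sin_sq_add_cos_sq (k 1)
  have hdet : !![p₁ δ k, σ * p₂ δ k, p₃ μ k; dp₁ δ 0 k, σ * dp₂ δ 0 k, dp₃ 0 k;
      dp₁ δ 1 k, σ * dp₂ δ 1 k, dp₃ 1 k].det = σ * δ ^ 2 *
        (1 - Real.cos (k 0) * Real.cos (k 1)) * (-(Real.sin (k 0) ^ 2 + Real.sin (k 1) ^ 2) -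
      p₃ μ k * (Real.cos (k 0) + Real.cos (k 1))) := by
    rw [Matrix.det_fin_three]
    simp only [p₁, p₂, dp₁, dp₂, dp₃, Matrix.of_apply, Matrix.cons_val]
    linear_combination σ * δ ^ 2 * (-(Real.sin (k 1) ^ 2) - p₃ μ k * Real.cos (k 1)) * h0 +
      σ * δ ^ 2 * (-(Real.sin (k 0) ^ 2) - p₃ μ k * Real.cos (k 0)) * h1
  rw [curvature, ← hdet, Matrix.det_fin_three, Matrix.det_fin_three]
  simp only [dDiv, Matrix.of_apply, Matrix.cons_val]
  generalize dEnergy μ δ 0 k = u, dEnergy μ δ 1 k = v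
  field_simp
  ring

/-- The Chern number is the mean curvature of `n`, times `π`. -/
lemma hasChernNumber_fermiProjection (hσ : σ = 1 ∨ σ = -1) (hδ : δ ≠ 0) (hμ : |μ| ≠ 4) :
    HasChernNumber (fermiProjection (hamiltonian σ μ δ))
      (Real.pi * ∫ t : Torus, toTorus (curvature σ μ δ) t) := by
  rw [(spectrum_and_fermiProjection hσ hδ hμ).2]
  refine ⟨_, _, isPositionCommutator_symbolOp 0 (hasPartial_fermiSymbol hδ hμ 0),
    isPositionCommutator_symbolOp 1 (hasPartial_fermiSymbol hδ hμ 1), ?_⟩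
  rw [← map_mul, ← map_mul, ← map_sub, ← map_mul, originTrace_symbolOp]
  have h₂ := (IsTorusFunction.const σ).mul (isTorusFunction_p₂ δ)
  have hI : Complex.I ^ 2 = -1 := Complex.I_sq
  have hI3 : Complex.I ^ 3 = -Complex.I := Complex.I_pow_three
  -- the products of Pauli matrices give `tr (P [∂₁P, ∂₂P]) = -(i/2) n · (∂₁n × ∂₂n)`
  have e : ∀ t : Torus, (fermiSymbol σ μ δ *
      ((-Complex.I • dFermiSymbol σ μ δ 1) * (-Complex.I • dFermiSymbol σ μ δ 0) -
        (-Complex.I • dFermiSymbol σ μ δ 0) * (-Complex.I • dFermiSymbol σ μ δ 1))).trace t =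
      -(Complex.I / 2) * toTorus (curvature σ μ δ) t := by
    intro t
    obtain ⟨k, rfl⟩ := isQuotientMap_torusPoint.surjective t
    rw [toTorus_torusPoint (isTorusFunction_curvature hδ hμ), ← curvature_eq_det hδ hμ,
      Matrix.det_fin_three]
    have v1 := toTorus_torusPoint (isTorusFunction_div_energy hδ hμ (isTorusFunction_p₁ δ)) k
    have v2 := toTorus_torusPoint (isTorusFunction_div_energy hδ hμ h₂) k
    have v3 := toTorus_torusPoint (isTorusFunction_div_energy hδ hμ (isTorusFunction_p₃ μ)) k
    have w1 := fun j => toTorus_torusPoint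
      (isTorusFunction_dDiv hδ hμ (j := j) (isTorusFunction_p₁ δ) (isTorusFunction_dp₁ δ j)) k
    have w2 := fun j => toTorus_torusPoint (isTorusFunction_dDiv hδ hμ (j := j) h₂
      ((IsTorusFunction.const σ).mul (isTorusFunction_dp₂ δ j))) k
    have w3 := fun j => toTorus_torusPoint
      (isTorusFunction_dDiv hδ hμ (j := j) (isTorusFunction_p₃ μ) (isTorusFunction_dp₃ j)) k
    rw [Matrix.trace_fin_two]
    simp only [fermiSymbol, dFermiSymbol, pauli, Matrix.mul_apply, Fin.sum_univ_two,
      Matrix.smul_apply, Matrix.sub_apply, Matrix.one_apply, Matrix.of_apply, Matrix.cons_val,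
      ContinuousMap.add_apply, ContinuousMap.sub_apply, ContinuousMap.mul_apply,
      ContinuousMap.smul_apply, ContinuousMap.neg_apply, v1, v2, v3, w1, w2, w3,
      algebraMap_apply, smul_eq_mul, ContinuousMap.one_apply, if_true]
    push_cast
    norm_num
    ring_nf
    simp only [hI3]
    ring
  simp only [e]
  rw [integral_const_mul]
  linear_combination (-Real.pi * ∫ t : Torus, toTorus (curvature σ μ δ) t) * hI

end Fermi

/-! ### The total curvature -/

section Curvature

variable {σ μ δ η : ℝ}

/-- With `w = 1 - cos k₁ cos k₂`, the function `δ² w / (E (E + η p₃)) = (1 - η n₃) / w`. For `η = ±1` the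
vector field `(sin k₁, sin k₂)` times this function has divergence proportional to the curvature, and is
smooth away from the points where `n₃ = -η`. -/
noncomputable def potential (μ δ η : ℝ) (k : Fin 2 → ℝ) : ℝ :=
  δ ^ 2 * (1 - Real.cos (k 0) * Real.cos (k 1)) / (energy μ δ k * (energy μ δ k + η * p₃ μ k))

/-- The partial derivative of `1 - cos k₁ cos k₂` with respect to `k_j`. -/
noncomputable def dWeight (j : Fin 2) (k : Fin 2 → ℝ) : ℝ :=
  ![Real.sin (k 0) * Real.cos (k 1), Real.cos (k 0) * Real.sin (k 1)] j

/-- The partial derivative of the potential with respect to `k_j`. -/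
noncomputable def dPotential (μ δ η : ℝ) (j : Fin 2) (k : Fin 2 → ℝ) : ℝ :=
  (δ ^ 2 * dWeight j k * (energy μ δ k * (energy μ δ k + η * p₃ μ k)) -
    δ ^ 2 * (1 - Real.cos (k 0) * Real.cos (k 1)) *
      (dEnergy μ δ j k * (energy μ δ k + η * p₃ μ k) +
        energy μ δ k * (dEnergy μ δ j k + η * dp₃ j k))) /
    (energy μ δ k * (energy μ δ k + η * p₃ μ k)) ^ 2

/-- The partial derivative with respect to `k_j` of `sin k_j` times the potential. -/
noncomputable def dField (μ δ η : ℝ) (j : Fin 2) (k : Fin 2 → ℝ) : ℝ :=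
  Real.cos (k j) * potential μ δ η k + Real.sin (k j) * dPotential μ δ η j k

lemma hasDerivAt_field (hδ : δ ≠ 0) (hμ : |μ| ≠ 4) (j : Fin 2) {k : Fin 2 → ℝ}
    (h : 0 < energy μ δ k + η * p₃ μ k) :
    HasDerivAt (fun s => Real.sin s * potential μ δ η (Function.update k j s))
      (dField μ δ η j k) (k j) := by
  have hw : HasDerivAt (fun s => 1 - Real.cos (Function.update k j s 0) *
      Real.cos (Function.update k j s 1)) (dWeight j k) (k j) := by
    unfold dWeight
    fin_cases j
    · simpa using ((Real.hasDerivAt_cos (k 0)).mul_const (Real.cos (k 1))).const_sub 1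
    · simpa using ((Real.hasDerivAt_cos (k 1)).const_mul (Real.cos (k 0))).const_sub 1
  have hE := hasDerivAt_energy hδ hμ j k
  have hp := hasDerivAt_p₃ μ j k
  have hψ := (hw.const_mul (δ ^ 2)).div (hE.mul (hE.add (hp.const_mul η))) (by
    simpa using ⟨(energy_pos hδ hμ k).ne', h.ne'⟩)
  have := (Real.hasDerivAt_sin (k j)).mul hψ
  simp only [Pi.mul_apply, Pi.add_apply, Pi.div_apply, Function.update_eq_self] at this
  exact this

lemma sin_mul_dEnergy (μ δ : ℝ) (k : Fin 2 → ℝ) :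
    Real.sin (k 0) * dEnergy μ δ 0 k + Real.sin (k 1) * dEnergy μ δ 1 k =
      ((energy μ δ k ^ 2 - p₃ μ k ^ 2) * (Real.cos (k 0) + Real.cos (k 1)) +
        p₃ μ k * -(Real.sin (k 0) ^ 2 + Real.sin (k 1) ^ 2)) / energy μ δ k := by
  have h0 := Real.sin_sq_add_cos_sq (k 0)
  have h1 := Real.sin_sq_add_cos_sq (k 1)
  have hE := energy_sq μ δ k
  have h12 := p₁_sq_add_p₂_sq δ k
  have e : Real.sin (k 0) * (p₁ δ k * dp₁ δ 0 k + p₂ δ k * dp₂ δ 0 k) +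
      Real.sin (k 1) * (p₁ δ k * dp₁ δ 1 k + p₂ δ k * dp₂ δ 1 k) =
      δ ^ 2 * (1 - Real.cos (k 0) * Real.cos (k 1)) ^ 2 * (Real.cos (k 0) + Real.cos (k 1)) := by
    simp only [p₁, p₂, dp₁, dp₂, Matrix.cons_val]
    have e0 : Real.sin (k 0) ^ 2 = 1 - Real.cos (k 0) ^ 2 := by linarith
    have e1 : Real.sin (k 1) ^ 2 = 1 - Real.cos (k 1) ^ 2 := by linarith
    ring_nf
    simp only [e0, e1]
    ring
  simp only [dEnergy]
  rw [mul_div_assoc', mul_div_assoc', ← add_div]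
  congr 1
  simp only [dp₃]
  rw [hE, h12]
  linear_combination e

/-- The divergence of the potential field is the curvature, up to sign. -/
lemma curvature_eq_divergence (hδ : δ ≠ 0) (hμ : |μ| ≠ 4) (hη : η ^ 2 = 1) {k : Fin 2 → ℝ}
    (h : 0 < energy μ δ k + η * p₃ μ k) :
    curvature σ μ δ k = -(σ * η) * (dField μ δ η 0 k + dField μ δ η 1 k) := by
  have h0 := Real.sin_sq_add_cos_sq (k 0)
  have h1 := Real.sin_sq_add_cos_sq (k 1)
  have hVE := sin_mul_dEnergy μ δ k
  have hVw : Real.sin (k 0) * dWeight 0 k + Real.sin (k 1) * dWeight 1 k =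
      (Real.cos (k 0) + Real.cos (k 1)) * (1 - Real.cos (k 0) * Real.cos (k 1)) := by
    simp only [dWeight, Matrix.cons_val]
    linear_combination Real.cos (k 1) * h0 + Real.cos (k 0) * h1
  have hVp : Real.sin (k 0) * dp₃ 0 k + Real.sin (k 1) * dp₃ 1 k =
      -(Real.sin (k 0) ^ 2 + Real.sin (k 1) ^ 2) := by
    simp only [dp₃]; ring
  have hE := (energy_pos hδ hμ k).ne'
  have hD := h.ne'
  have hdiv : dField μ δ η 0 k + dField μ δ η 1 k =
      (Real.cos (k 0) + Real.cos (k 1)) * potential μ δ η k +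
      (δ ^ 2 * (Real.sin (k 0) * dWeight 0 k + Real.sin (k 1) * dWeight 1 k) *
        (energy μ δ k * (energy μ δ k + η * p₃ μ k)) -
      δ ^ 2 * (1 - Real.cos (k 0) * Real.cos (k 1)) *
        ((Real.sin (k 0) * dEnergy μ δ 0 k + Real.sin (k 1) * dEnergy μ δ 1 k) *
          (2 * energy μ δ k + η * p₃ μ k) +
        energy μ δ k * η * (Real.sin (k 0) * dp₃ 0 k + Real.sin (k 1) * dp₃ 1 k))) /
      (energy μ δ k * (energy μ δ k + η * p₃ μ k)) ^ 2 := by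
    simp only [dField, dPotential]
    ring
  rw [hdiv, hVE, hVw, hVp, curvature, potential]
  generalize -(Real.sin (k 0) ^ 2 + Real.sin (k 1) ^ 2) = b,
    Real.cos (k 0) + Real.cos (k 1) = C, 1 - Real.cos (k 0) * Real.cos (k 1) = w,
    energy μ δ k = E, p₃ μ k = p at *
  have hb : C * (δ ^ 2 * w / (E * (E + η * p))) +
      (δ ^ 2 * (C * w) * (E * (E + η * p)) -
        δ ^ 2 * w * (((E ^ 2 - p ^ 2) * C + p * b) / E * (2 * E + η * p) + E * η * b)) /
      (E * (E + η * p)) ^ 2 = -η * δ ^ 2 * w * (b - p * C) / E ^ 3 := by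
    field_simp
    linear_combination (w * (2 * E * p + η * p ^ 2) * (b - p * C)) * hη
  rw [hb]
  linear_combination (-(σ * δ ^ 2 * w * (b - p * C) / E ^ 3)) * hη

lemma continuousOn_dField (hδ : δ ≠ 0) (hμ : |μ| ≠ 4) (j : Fin 2) :
    ContinuousOn (dField μ δ η j) {k | 0 < energy μ δ k + η * p₃ μ k} := by
  have hE := (isTorusFunction_energy μ δ).continuous
  have hp := (isTorusFunction_p₃ μ).continuous
  have hdE : Continuous (dEnergy μ δ j) := (isTorusFunction_div_energy hδ hμ
    ((((isTorusFunction_p₁ δ).mul (isTorusFunction_dp₁ δ j)).add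
      ((isTorusFunction_p₂ δ).mul (isTorusFunction_dp₂ δ j))).add
      ((isTorusFunction_p₃ μ).mul (isTorusFunction_dp₃ j)))).continuous
  have hdp := (isTorusFunction_dp₃ j).continuous
  have hw : Continuous (dWeight j) := by
    unfold dWeight
    fin_cases j <;> simp <;> fun_prop
  have h0 : ∀ k ∈ {k | 0 < energy μ δ k + η * p₃ μ k},
      energy μ δ k * (energy μ δ k + η * p₃ μ k) ≠ 0 := fun k hk =>
    mul_ne_zero (energy_pos hδ hμ k).ne' (ne_of_gt hk)
  have hψ : ContinuousOn (potential μ δ η) {k | 0 < energy μ δ k + η * p₃ μ k} :=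
    ContinuousOn.div (by fun_prop) (by fun_prop) h0
  have hdψ : ContinuousOn (dPotential μ δ η j) {k | 0 < energy μ δ k + η * p₃ μ k} :=
    ContinuousOn.div (by fun_prop) (by fun_prop) fun k hk => pow_ne_zero 2 (h0 k hk)
  exact (Continuous.continuousOn (by fun_prop)).mul hψ |>.add
    ((Continuous.continuousOn (by fun_prop)).mul hdψ)

/-- Stokes' theorem on the strip `u ≤ k₁ ≤ v`. By periodicity in `k₂` only the two boundary circles
contribute. -/
lemma integral_curvature_strip (hδ : δ ≠ 0) (hμ : |μ| ≠ 4) (hη : η ^ 2 = 1) {u v : ℝ}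
    (huv : u ≤ v) (h : ∀ a ∈ Set.Icc u v, ∀ b, 0 < energy μ δ ![a, b] + η * p₃ μ ![a, b]) :
    ∫ a in u..v, ∫ b in (0 : ℝ)..2 * Real.pi, curvature σ μ δ ![a, b] =
      -(σ * η) * ((∫ b in (0 : ℝ)..2 * Real.pi, Real.sin v * potential μ δ η ![v, b]) -
        ∫ b in (0 : ℝ)..2 * Real.pi, Real.sin u * potential μ δ η ![u, b]) := by
  have hup0 : ∀ a b s : ℝ, Function.update ![a, b] 0 s = ![s, b] := by
    intro a b s; funext i; fin_cases i <;> rfl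
  have hup1 : ∀ a b s : ℝ, Function.update ![a, b] 1 s = ![a, s] := by
    intro a b s; funext i; fin_cases i <;> rfl
  have hcont : ∀ j, ContinuousOn (fun x : ℝ × ℝ => dField μ δ η j ![x.1, x.2])
      (Set.Icc u v ×ˢ Set.univ) := fun j =>
    (continuousOn_dField hδ hμ j).comp (by fun_prop) fun x hx => h x.1 hx.1 x.2
  have hc0 : ∀ b, ContinuousOn (fun a => dField μ δ η 0 ![a, b]) (Set.Icc u v) := fun b =>
    (hcont 0).comp (f := fun a : ℝ => (a, b)) (by fun_prop) fun a ha => ⟨ha, trivial⟩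
  have hc1 : ∀ j, ∀ a ∈ Set.Icc u v, Continuous fun b => dField μ δ η j ![a, b] := by
    intro j a ha
    rw [← continuousOn_univ]
    exact (hcont j).comp (f := fun b : ℝ => (a, b)) (by fun_prop) fun b _ => ⟨ha, trivial⟩
  -- the `k₂`-derivative integrates to zero over a period
  have hinner : ∀ a ∈ Set.Icc u v, ∫ b in (0 : ℝ)..2 * Real.pi, curvature σ μ δ ![a, b] =
      -(σ * η) * ∫ b in (0 : ℝ)..2 * Real.pi, dField μ δ η 0 ![a, b] := by
    intro a ha
    have hz : ∫ b in (0 : ℝ)..2 * Real.pi, dField μ δ η 1 ![a, b] = 0 := by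
      rw [intervalIntegral.integral_eq_sub_of_hasDerivAt
        (f := fun s => Real.sin s * potential μ δ η ![a, s])]
      · simp [potential, energy, p₁, p₂, p₃]
      · intro b _
        have := hasDerivAt_field hδ hμ 1 (h a ha b)
        simp only [hup1] at this
        exact this
      · exact (hc1 1 a ha).intervalIntegrable _ _
    have : ∀ b, curvature σ μ δ ![a, b] =
        -(σ * η) * (dField μ δ η 0 ![a, b] + dField μ δ η 1 ![a, b]) := fun b =>
      curvature_eq_divergence hδ hμ hη (h a ha b)
    simp only [this]
    rw [intervalIntegral.integral_const_mul, intervalIntegral.integral_add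
      ((hc1 0 a ha).intervalIntegrable _ _) ((hc1 1 a ha).intervalIntegrable _ _), hz, add_zero]
  rw [intervalIntegral.integral_congr (g := fun a => -(σ * η) *
    ∫ b in (0 : ℝ)..2 * Real.pi, dField μ δ η 0 ![a, b])
    (fun a ha => hinner a (by rwa [Set.uIcc_of_le huv] at ha)),
    intervalIntegral.integral_const_mul, intervalIntegral_intervalIntegral_swap]
  · have hψ : ∀ a ∈ Set.Icc u v, Continuous fun b => Real.sin a * potential μ δ η ![a, b] := by
      intro a ha
      have hE : Continuous fun b => energy μ δ ![a, b] :=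
        (isTorusFunction_energy μ δ).continuous.comp (by fun_prop)
      have hp : Continuous fun b => p₃ μ ![a, b] :=
        (isTorusFunction_p₃ μ).continuous.comp (by fun_prop)
      refine continuous_const.mul (Continuous.div (by fun_prop) (by fun_prop) fun b => ?_)
      exact mul_ne_zero (energy_pos hδ hμ _).ne' (h a ha b).ne'
    rw [← intervalIntegral.integral_sub
      ((hψ v (Set.right_mem_Icc.mpr huv)).intervalIntegrable _ _)
      ((hψ u (Set.left_mem_Icc.mpr huv)).intervalIntegrable _ _)]
    congr 1
    refine intervalIntegral.integral_congr fun b _ => ?_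
    refine intervalIntegral.integral_eq_sub_of_hasDerivAt
      (f := fun s => Real.sin s * potential μ δ η ![s, b]) (fun a ha => ?_) ?_
    · rw [Set.uIcc_of_le huv] at ha
      have := hasDerivAt_field hδ hμ 0 (h a ha b)
      simp only [hup0] at this
      exact this
    · exact ContinuousOn.intervalIntegrable (by rw [Set.uIcc_of_le huv]; exact hc0 b)
  · have hK : ContinuousOn (fun x : ℝ × ℝ => dField μ δ η 0 ![x.1, x.2])
        (Set.Icc u v ×ˢ Set.Icc 0 (2 * Real.pi)) :=
      (hcont 0).mono (Set.prod_mono subset_rfl (Set.subset_univ _))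
    refine (hK.integrableOn_compact (isCompact_Icc.prod isCompact_Icc)).mono_set ?_
    rw [Set.uIoc_of_le huv, Set.uIoc_of_le (by positivity)]
    exact Set.prod_mono Set.Ioc_subset_Icc_self Set.Ioc_subset_Icc_self

/-- The denominator of the potential is positive on a strip that contains only one of the two points
`(0, 0)` and `(π, π)`, where `cos k₁ = cos k₂ = c`, if `η` is the sign of `p₃` there. -/
lemma energy_add_pos (hδ : δ ≠ 0) (hη : η ^ 2 = 1) {c : ℝ} (hc : 0 < η * (2 * c - μ / 2))
    {k : Fin 2 → ℝ} (hk : 1 - Real.cos (k 0) * Real.cos (k 1) = 0 →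
      Real.cos (k 0) = c ∧ Real.cos (k 1) = c) :
    0 < energy μ δ k + η * p₃ μ k := by
  have hE0 : 0 ≤ energy μ δ k := Real.sqrt_nonneg _
  have hE := energy_sq μ δ k
  rw [p₁_sq_add_p₂_sq] at hE
  by_cases hw : 1 - Real.cos (k 0) * Real.cos (k 1) = 0
  · obtain ⟨h0, h1⟩ := hk hw
    have : η * p₃ μ k = η * (2 * c - μ / 2) := by rw [p₃, h0, h1]; ring
    linarith
  · have hpos : 0 < δ ^ 2 * (1 - Real.cos (k 0) * Real.cos (k 1)) ^ 2 := by positivity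
    have : (η * p₃ μ k) ^ 2 < energy μ δ k ^ 2 := by
      rw [mul_pow, hη, one_mul]; linarith
    linarith [(abs_lt.mp (abs_lt_of_sq_lt_sq this hE0)).1]

/-- On the circles `cos k₁ = 0` the potential is `1 - η n₃`. -/
lemma potential_of_cos_eq_zero (hδ : δ ≠ 0) (hμ : |μ| ≠ 4) (hη : η ^ 2 = 1) {k : Fin 2 → ℝ}
    (hk : Real.cos (k 0) = 0) (h : 0 < energy μ δ k + η * p₃ μ k) :
    potential μ δ η k = 1 - η * (p₃ μ k / energy μ δ k) := by
  have hE := energy_sq μ δ k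
  have hE0 := (energy_pos hδ hμ k).ne'
  have h0 := h.ne'
  rw [p₁_sq_add_p₂_sq, hk] at hE
  rw [potential, hk]
  field_simp
  linear_combination -hE + p₃ μ k ^ 2 * hη

/-- The total curvature is `4π` times the difference of the values `η₁`, `η₀` of `n₃` at `(π, π)` and
at `(0, 0)`. The circles `k₁ = ±π/2` cut the torus into two cylinders, each with its own potential; the
contributions of `n₃` on the circles cancel. -/
lemma integral_curvature (hδ : δ ≠ 0) (hμ : |μ| ≠ 4) {η₀ η₁ : ℝ} (hη₀ : η₀ ^ 2 = 1)
    (hη₁ : η₁ ^ 2 = 1) (h₀ : 0 < η₀ * (2 - μ / 2)) (h₁ : 0 < η₁ * (-2 - μ / 2)) :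
    ∫ a in -(Real.pi / 2)..-(Real.pi / 2) + 2 * Real.pi, ∫ b in (0 : ℝ)..2 * Real.pi,
      curvature σ μ δ ![a, b] = 4 * Real.pi * σ * (η₁ - η₀) := by
  have hpi := Real.pi_pos
  have hpos₀ : ∀ a ∈ Set.Icc (-(Real.pi / 2)) (Real.pi / 2), ∀ b,
      0 < energy μ δ ![a, b] + η₀ * p₃ μ ![a, b] := by
    intro a ha b
    refine energy_add_pos hδ hη₀ (c := 1) (by linarith) fun hw => ?_
    have hc : 0 ≤ Real.cos a := Real.cos_nonneg_of_mem_Icc ha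
    rcases cos_eq_of_cos_mul_cos_eq_one hw with h | h
    · exact h
    · have : Real.cos a = -1 := h.1
      linarith
  have hpos₁ : ∀ a ∈ Set.Icc (Real.pi / 2) (-(Real.pi / 2) + 2 * Real.pi), ∀ b,
      0 < energy μ δ ![a, b] + η₁ * p₃ μ ![a, b] := by
    intro a ha b
    refine energy_add_pos hδ hη₁ (c := -1) (by linarith) fun hw => ?_
    have hc : Real.cos a ≤ 0 :=
      Real.cos_nonpos_of_pi_div_two_le_of_le ha.1 (by linarith [ha.2])
    rcases cos_eq_of_cos_mul_cos_eq_one hw with h | h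
    · have : Real.cos a = 1 := h.1
      linarith
    · exact h
  have hcont : Continuous fun x : ℝ × ℝ => curvature σ μ δ ![x.1, x.2] :=
    (isTorusFunction_curvature hδ hμ).continuous.comp (by fun_prop)
  have hint : ∀ u v, IntervalIntegrable
      (fun a => ∫ b in (0 : ℝ)..2 * Real.pi, curvature σ μ δ ![a, b]) volume u v := fun u v =>
    (intervalIntegral.continuous_parametric_intervalIntegral_of_continuous'
      (f := fun a b => curvature σ μ δ ![a, b]) hcont 0 (2 * Real.pi)).intervalIntegrable u v
  rw [← intervalIntegral.integral_add_adjacent_intervals (hint _ (Real.pi / 2)) (hint _ _),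
    integral_curvature_strip hδ hμ hη₀ (by linarith) hpos₀,
    integral_curvature_strip hδ hμ hη₁ (by linarith) hpos₁]
  have hcos : Real.cos (-(Real.pi / 2) + 2 * Real.pi) = 0 := by simp
  have hsin : Real.sin (-(Real.pi / 2) + 2 * Real.pi) = -1 := by simp
  set N := ∫ b in (0 : ℝ)..2 * Real.pi, p₃ μ ![Real.pi / 2, b] / energy μ δ ![Real.pi / 2, b]
    with hN
  have hn : Continuous fun b => p₃ μ ![Real.pi / 2, b] / energy μ δ ![Real.pi / 2, b] :=
    (isTorusFunction_div_energy hδ hμ (isTorusFunction_p₃ μ)).continuous.comp (by fun_prop)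
  -- `n₃` takes the same values on the two circles, being even in `k₁`
  have hcirc : ∀ (η a : ℝ), η ^ 2 = 1 → Real.cos a = 0 →
      (∀ b, 0 < energy μ δ ![a, b] + η * p₃ μ ![a, b]) →
      ∫ b in (0 : ℝ)..2 * Real.pi, potential μ δ η ![a, b] = 2 * Real.pi - η * N := by
    intro η a hη ha hpos
    have e : ∀ b, potential μ δ η ![a, b] =
        1 - η * (p₃ μ ![Real.pi / 2, b] / energy μ δ ![Real.pi / 2, b]) := by
      intro b
      rw [potential_of_cos_eq_zero hδ hμ hη ha (hpos b), energy, energy, p₁_sq_add_p₂_sq,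
        p₁_sq_add_p₂_sq]
      simp [p₃, ha]
    simp only [e]
    rw [intervalIntegral.integral_sub (by simp) ((hn.const_mul η).intervalIntegrable _ _),
      intervalIntegral.integral_const_mul]
    simp [hN]
  simp only [intervalIntegral.integral_const_mul]
  rw [hcirc η₀ (Real.pi / 2) hη₀ Real.cos_pi_div_two
      (hpos₀ _ (Set.right_mem_Icc.mpr (by linarith))),
    hcirc η₀ (-(Real.pi / 2)) hη₀ (by simp) (hpos₀ _ (Set.left_mem_Icc.mpr (by linarith))),
    hcirc η₁ (Real.pi / 2) hη₁ Real.cos_pi_div_two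
      (hpos₁ _ (Set.left_mem_Icc.mpr (by linarith))),
    hcirc η₁ _ hη₁ hcos (hpos₁ _ (Set.right_mem_Icc.mpr (by linarith))), hsin, Real.sin_neg,
    Real.sin_pi_div_two]
  linear_combination (2 * σ * N) * (hη₀ - hη₁)

/-- The Chern number counts the signed values of `n₃` at the two zeros of `(p₁, p₂)`. -/
lemma hasChernNumber_sign (hσ : σ = 1 ∨ σ = -1) (hδ : δ ≠ 0) (hμ : |μ| ≠ 4) {η₀ η₁ : ℝ}
    (hη₀ : η₀ ^ 2 = 1) (hη₁ : η₁ ^ 2 = 1) (h₀ : 0 < η₀ * (2 - μ / 2))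
    (h₁ : 0 < η₁ * (-2 - μ / 2)) :
    HasChernNumber (fermiProjection (hamiltonian σ μ δ)) ((σ * (η₁ - η₀) : ℝ) : ℂ) := by
  have h := hasChernNumber_fermiProjection hσ hδ hμ
  rw [integral_torus_eq (toTorus (curvature σ μ δ)).continuous (-(Real.pi / 2)) 0] at h
  simp only [toTorus_torusPoint (isTorusFunction_curvature hδ hμ),
    intervalIntegral.integral_ofReal, zero_add] at h
  rw [integral_curvature hδ hμ hη₀ hη₁ h₀ h₁] at h
  convert h using 1
  have hpi : (Real.pi : ℂ) ≠ 0 := by exact_mod_cast Real.pi_ne_zero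
  push_cast
  field_simp
  ring

end Curvature

/-! ### The lower Bloch bundle -/

section Bundle

variable {σ μ δ : ℝ}

lemma mem_lowerBlochFibre {k : Fin 2 → ℝ} {v : Spinor} :
    v ∈ lowerBlochFibre σ μ δ k ↔
      (p₃ μ k : ℂ) * v 0 + (p₁ δ k - σ * Complex.I * p₂ δ k) * v 1 = -(energy μ δ k : ℂ) * v 0 ∧
      (p₁ δ k + σ * Complex.I * p₂ δ k) * v 0 - (p₃ μ k : ℂ) * v 1 = -(energy μ δ k : ℂ) * v 1 := by
  have hE : (lowerBand μ δ k : ℂ) = -(energy μ δ k : ℂ) := by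
    rw [lowerBand, energy, Complex.ofReal_neg]
  rw [lowerBlochFibre, Module.End.mem_eigenspace_iff, hE]
  constructor
  · intro h
    have h0 := congrArg (fun w : Spinor => w 0) h
    have h1 := congrArg (fun w : Spinor => w 1) h
    simp [blochHamiltonian, Matrix.toEuclideanLin, Matrix.mulVec, dotProduct, Fin.sum_univ_two] at h0 h1
    exact ⟨by linear_combination h0, by linear_combination h1⟩
  · rintro ⟨h0, h1⟩
    ext a
    fin_cases a
    · simp [blochHamiltonian, Matrix.toEuclideanLin, Matrix.mulVec, dotProduct, Fin.sum_univ_two]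
      linear_combination h0
    · simp [blochHamiltonian, Matrix.toEuclideanLin, Matrix.mulVec, dotProduct, Fin.sum_univ_two]
      linear_combination h1

/-- The lower Bloch fibres are one-dimensional, so a unit vector in a fibre spans it. -/
lemma span_eq_lowerBlochFibre (hδ : δ ≠ 0) (hμ : |μ| ≠ 4) {k : Fin 2 → ℝ} {v : Spinor}
    (hv : v ∈ lowerBlochFibre σ μ δ k) (hn : ‖v‖ = 1) :
    Submodule.span ℂ {v} = lowerBlochFibre σ μ δ k := by
  refine le_antisymm ((Submodule.span_singleton_le_iff_mem _ _).mpr hv) fun w hw => ?_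
  obtain ⟨v0, v1⟩ := mem_lowerBlochFibre.mp hv
  obtain ⟨w0, w1⟩ := mem_lowerBlochFibre.mp hw
  have hE : (2 * energy μ δ k : ℂ) ≠ 0 := by
    exact_mod_cast (mul_pos two_pos (energy_pos hδ hμ k)).ne'
  -- `v` and `w` solve the same two equations, whose diagonal coefficients have the sum `2E ≠ 0`
  have hdet : v 0 * w 1 - w 0 * v 1 = 0 := by
    refine (mul_eq_zero.mp ?_).resolve_left hE
    linear_combination w 1 * v0 - v 1 * w0 - w 0 * v1 + v 0 * w1
  have hnorm : (starRingEnd ℂ) (v 0) * v 0 + (starRingEnd ℂ) (v 1) * v 1 = 1 := by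
    have h := EuclideanSpace.norm_sq_eq v
    rw [hn, Fin.sum_univ_two] at h
    rw [Complex.conj_mul', Complex.conj_mul']
    exact_mod_cast h.symm.trans (one_pow 2)
  refine Submodule.mem_span_singleton.mpr
    ⟨(starRingEnd ℂ) (v 0) * w 0 + (starRingEnd ℂ) (v 1) * w 1, ?_⟩
  ext a
  fin_cases a
  · simp
    linear_combination w 0 * hnorm + (starRingEnd ℂ) (v 1) * hdet
  · simp
    linear_combination w 1 * hnorm - (starRingEnd ℂ) (v 0) * hdet

/-- A smooth periodic unit vector field in the lower band is a global section. -/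
lemma hasGlobalBlochSection_of_mem (hδ : δ ≠ 0) (hμ : |μ| ≠ 4) {x₀ y₀ x₁ y₁ : (Fin 2 → ℝ) → ℝ}
    (hx₀ : ContDiff ℝ ∞ x₀) (hy₀ : ContDiff ℝ ∞ y₀) (hx₁ : ContDiff ℝ ∞ x₁)
    (hy₁ : ContDiff ℝ ∞ y₁) (px₀ : IsTorusFunction x₀) (py₀ : IsTorusFunction y₀)
    (px₁ : IsTorusFunction x₁) (py₁ : IsTorusFunction y₁)
    (hn : ∀ k, x₀ k ^ 2 + y₀ k ^ 2 + x₁ k ^ 2 + y₁ k ^ 2 = 1)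
    (hmem : ∀ k, !₂[(x₀ k + y₀ k * Complex.I : ℂ), (x₁ k + y₁ k * Complex.I : ℂ)] ∈
      lowerBlochFibre σ μ δ k) : HasGlobalBlochSection σ μ δ := by
  have hsmooth : ∀ {x y : (Fin 2 → ℝ) → ℝ}, ContDiff ℝ ∞ x → ContDiff ℝ ∞ y →
      ContDiff ℝ ∞ fun k => (x k + y k * Complex.I : ℂ) := fun hx hy =>
    (Complex.ofRealCLM.contDiff.comp hx).add ((Complex.ofRealCLM.contDiff.comp hy).mul contDiff_const)
  have hnorm : ∀ k, ‖!₂[(x₀ k + y₀ k * Complex.I : ℂ), (x₁ k + y₁ k * Complex.I : ℂ)]‖ = 1 := by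
    intro k
    rw [EuclideanSpace.norm_eq, Real.sqrt_eq_one, Fin.sum_univ_two]
    simp only [Matrix.cons_val, ← Complex.normSq_eq_norm_sq, Complex.normSq_add_mul_I]
    linarith [hn k]
  refine ⟨fun k => !₂[(x₀ k + y₀ k * Complex.I : ℂ), (x₁ k + y₁ k * Complex.I : ℂ)], ?_, ?_,
    hnorm, fun k => span_eq_lowerBlochFibre hδ hμ (hmem k) (hnorm k)⟩
  · refine (contDiff_piLp 2).mpr fun a => ?_
    fin_cases a
    · exact hsmooth hx₀ hy₀
    · exact hsmooth hx₁ hy₁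
  · intro k j
    simp only [px₀.periodic, py₀.periodic, px₁.periodic, py₁.periodic]

lemma contDiff_p₁ : ContDiff ℝ ∞ (p₁ δ) := by unfold p₁; fun_prop

lemma contDiff_p₂ : ContDiff ℝ ∞ (p₂ δ) := by unfold p₂; fun_prop

lemma contDiff_p₃ : ContDiff ℝ ∞ (p₃ μ) := by unfold p₃; fun_prop

lemma contDiff_energy (hδ : δ ≠ 0) (hμ : |μ| ≠ 4) : ContDiff ℝ ∞ (energy μ δ) :=
  (((contDiff_p₁.pow 2).add (contDiff_p₂.pow 2)).add (contDiff_p₃.pow 2)).sqrt fun k => by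
    have := (energy_pos hδ hμ k).ne'
    rw [energy, Real.sqrt_ne_zero'] at this
    exact this.ne'

/-- If `p₃` has the constant sign `η`, then `n₃ ≠ -η` everywhere, and projecting the lower spin state
for `η = 1`, the upper one for `η = -1`, onto the lower band gives a nowhere vanishing section. -/
lemma hasGlobalBlochSection_of_sign (hσ : σ = 1 ∨ σ = -1) (hδ : δ ≠ 0) (hμ : |μ| ≠ 4) {η : ℝ}
    (hη : η = 1 ∨ η = -1) (h : ∀ k, 0 < η * p₃ μ k) : HasGlobalBlochSection σ μ δ := by
  have hη2 : η ^ 2 = 1 := by rcases hη with rfl | rfl <;> norm_num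
  have hσ2 : σ ^ 2 = 1 := by rcases hσ with rfl | rfl <;> norm_num
  have hE0 := energy_pos hδ hμ
  set N : (Fin 2 → ℝ) → ℝ := fun k =>
    Real.sqrt (2 * energy μ δ k * (energy μ δ k + η * p₃ μ k)) with hN
  have hD : ∀ k, 0 < 2 * energy μ δ k * (energy μ δ k + η * p₃ μ k) := fun k =>
    mul_pos (mul_pos two_pos (hE0 k)) (add_pos (hE0 k) (h k))
  have hN0 : ∀ k, 0 < N k := fun k => Real.sqrt_pos.mpr (hD k)
  have hN2 : ∀ k, N k ^ 2 = 2 * energy μ δ k * (energy μ δ k + η * p₃ μ k) := fun k =>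
    Real.sq_sqrt (hD k).le
  have hEs := contDiff_energy hδ hμ
  have hps := contDiff_p₃ (μ := μ)
  have hNs : ContDiff ℝ ∞ N := ContDiff.sqrt (by fun_prop) fun k => (hD k).ne'
  have hEt := isTorusFunction_energy μ δ
  have hpt := (IsTorusFunction.const η).mul (isTorusFunction_p₃ μ)
  have hNt : IsTorusFunction N := (((IsTorusFunction.const 2).mul hEt).mul (hEt.add hpt)).sqrt
  have hNne : ∀ k, N k ≠ 0 := fun k => (hN0 k).ne'
  have hnorm : ∀ k, (-1 * p₁ δ k / N k) ^ 2 + (σ * p₂ δ k / N k) ^ 2 +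
      ((energy μ δ k + η * p₃ μ k) / N k) ^ 2 = 1 := by
    intro k
    have hNk := hNne k
    have hE := energy_sq μ δ k
    field_simp
    rw [hN2, hσ2]
    linear_combination p₃ μ k ^ 2 * hη2 - hE
  have hNC : ∀ k, (N k : ℂ) ≠ 0 := fun k => by exact_mod_cast hNne k
  have hEC : ∀ k, (energy μ δ k : ℂ) ^ 2 = p₁ δ k ^ 2 + p₂ δ k ^ 2 + p₃ μ k ^ 2 := fun k => by
    exact_mod_cast energy_sq μ δ k
  have hσC : (σ : ℂ) ^ 2 = 1 := by exact_mod_cast hσ2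
  have hI : Complex.I ^ 2 = -1 := Complex.I_sq
  have s₁ : ContDiff ℝ ∞ fun k => -1 * p₁ δ k / N k :=
    (contDiff_const.mul contDiff_p₁).div hNs hNne
  have s₃ : ContDiff ℝ ∞ fun k => (energy μ δ k + η * p₃ μ k) / N k :=
    (hEs.add (contDiff_const.mul hps)).div hNs hNne
  have t₁ : IsTorusFunction fun k => -1 * p₁ δ k / N k :=
    ((IsTorusFunction.const _).mul (isTorusFunction_p₁ δ)).div hNt hNne
  have t₃ : IsTorusFunction fun k => (energy μ δ k + η * p₃ μ k) / N k :=
    (hEt.add hpt).div hNt hNne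
  have s₂ : ∀ c : ℝ, ContDiff ℝ ∞ fun k => c * p₂ δ k / N k := fun c =>
    (contDiff_const.mul contDiff_p₂).div hNs hNne
  have t₂ : ∀ c : ℝ, IsTorusFunction fun k => c * p₂ δ k / N k := fun c =>
    ((IsTorusFunction.const _).mul (isTorusFunction_p₂ δ)).div hNt hNne
  rcases hη with rfl | rfl
  · refine hasGlobalBlochSection_of_mem hδ hμ s₁ (s₂ σ) s₃ (contDiff_const (c := 0)) t₁ (t₂ σ) t₃
      (IsTorusFunction.const 0) (fun k => by linarith [hnorm k]) fun k => ?_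
    have hk := hNC k
    rw [mem_lowerBlochFibre]
    simp only [Matrix.cons_val]
    push_cast
    constructor
    · field_simp
      ring
    · field_simp
      linear_combination hEC k + p₂ δ k ^ 2 * Complex.I ^ 2 * hσC + p₂ δ k ^ 2 * hI
  · refine hasGlobalBlochSection_of_mem hδ hμ s₃ (contDiff_const (c := 0)) s₁ (s₂ (-σ)) t₃
      (IsTorusFunction.const 0) t₁ (t₂ (-σ)) (fun k => by
        have e : (-σ * p₂ δ k / N k) ^ 2 = (σ * p₂ δ k / N k) ^ 2 := by ring
        rw [e]
        linarith [hnorm k]) fun k => ?_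
    have hk := hNC k
    rw [mem_lowerBlochFibre]
    simp only [Matrix.cons_val]
    push_cast
    constructor
    · field_simp
      linear_combination hEC k + p₂ δ k ^ 2 * Complex.I ^ 2 * hσC + p₂ δ k ^ 2 * hI
    · field_simp
      ring

end Bundle

end BdG

theorem mainTheorem6 (σ μ δ : ℝ) (hσ : σ = 1 ∨ σ = -1) (hδ : δ ≠ 0) (hμ : |μ| ≠ 4) :
    IsSelfAdjoint (BdG.hamiltonian σ μ δ) ∧
    (0 : ℂ) ∉ spectrum ℂ (BdG.hamiltonian σ μ δ) ∧
    (|μ| < 4 →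
      BdG.HasChernNumber (BdG.fermiProjection (BdG.hamiltonian σ μ δ)) (-(2 * σ : ℂ))) ∧
    (4 < |μ| →
      BdG.HasChernNumber (BdG.fermiProjection (BdG.hamiltonian σ μ δ)) 0 ∧
      BdG.HasGlobalBlochSection σ μ δ) := by
  refine ⟨BdG.isSelfAdjoint_hamiltonian σ μ δ, (BdG.spectrum_and_fermiProjection hσ hδ hμ).1,
    fun h => ?_, fun h => ?_⟩
  · obtain ⟨h1, h2⟩ := abs_lt.mp h
    have := BdG.hasChernNumber_sign hσ hδ hμ (η₀ := 1) (η₁ := -1) (by norm_num) (by norm_num)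
      (by linarith) (by linarith)
    convert this using 1
    push_cast
    ring
  · have hcos : ∀ k : Fin 2 → ℝ, |Real.cos (k 0) + Real.cos (k 1)| ≤ 2 := fun k =>
      (abs_add_le _ _).trans (by linarith [Real.abs_cos_le_one (k 0), Real.abs_cos_le_one (k 1)])
    rcases lt_abs.mp h with h | h
    · refine ⟨?_, BdG.hasGlobalBlochSection_of_sign hσ hδ hμ (Or.inr rfl) fun k => ?_⟩
      · have := BdG.hasChernNumber_sign hσ hδ hμ (η₀ := -1) (η₁ := -1) (by norm_num)
          (by norm_num) (by linarith) (by linarith)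
        simpa using this
      · have := (abs_le.mp (hcos k)).2
        rw [BdG.p₃]
        linarith
    · refine ⟨?_, BdG.hasGlobalBlochSection_of_sign hσ hδ hμ (Or.inl rfl) fun k => ?_⟩
      · have := BdG.hasChernNumber_sign hσ hδ hμ (η₀ := 1) (η₁ := 1) (by norm_num)
          (by norm_num) (by linarith) (by linarith)
        simpa using this
      · have := (abs_le.mp (hcos k)).1
        rw [BdG.p₃]
        linarith
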